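/- Let $(\mathscr C,\mathbb T)$, $\mathbb T=(T,p,0,+,\ell,c)$, be a tangent category in the sense of Cockett and Cruttwell: $T:\mathscr C\to\mathscr C$ is a functor; $p:T\Rightarrow \mathrm{id}$, $0:\mathrm{id}\Rightarrow T$, $+:T_2\Rightarrow T$, $\ell:T\Rightarrow T^2$, $c:T^2\Rightarrow T^2$ are natural transformations, where $T_2X=TX\times_XTX$; all finite pullback powers of each $p_X$ exist and are preserved by all $T^m$; each $(p_X,+_X,0_X)$ is an additive bundle (a commutative monoid in $\mathscr C_{/X}$); $(\ell_X,0_X):p_X\to T(p_X)$ and $(c_X,\mathrm{id}_{TX}):T(p_X)\to p_{TX}$ are additive bundle morphisms; $c^2=\mathrm{id}$, $c\,\ell=\ell$, $T(\ell)\,\ell=\ell_T\,\ell$, $T(c)\,c_T\,T(c)=c_T\,T(c)\,c_T$, $c_T\,T(c)\,\ell_T=T(\ell)\,c$; and $T(+_X)\circ\langle \ell_X\pi_1,0_{TX}\pi_2\rangle:T_2X\to T^2X$ is an equalizer of $T(p_X)$ and $0_X\,p_X\,p_{TX}$. A differential bundle on $q:E\to M$ in a tangent category consists of an additive bundle structure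 $\sigma:E_2=E\times_ME\to E$, $\zeta:M\to E$ and a lift $\lambda:E\to TE$ such that all finite pullback powers of $q$ exist and are preserved by all $T^m$; $(\lambda,0_M):(q,\sigma,\zeta)\to(Tq,T\sigma,T\zeta)$ and $(\lambda,\zeta):(q,\sigma,\zeta)\to(p_E,+_E,0_E)$ are additive bundle morphisms; $\ell_E\lambda=T(\lambda)\lambda$; and, with $\mu=T(\sigma)\circ\langle\lambda\pi_0,0_E\pi_1\rangle:E_2\to TE$, the square $T(q)\circ\mu=0_M\circ(q\pi_1)$ is a pullback preserved by all $T^n$. A morphism $(f,g)$ from $(q,\sigma,\zeta,\lambda)$ to $(q',\sigma',\zeta',\lambda')$ is a commuting square $q'f=gq$; it is linear if $\lambda' f=T(f)\lambda$. An object $X$ is a differential object if the unique map from $X$ to a terminal object carries a differential bundle structure. The category $\mathrm{Ind}(\mathscr C)$ has as objects the functors $\underline X=(X_i)_{i\in I}$ from small filtered categories $I$ to $\mathscr C$, with $\mathrm{Ind}(\mathscr C)(\underline X,\underline Y)=\varprojlim_i\varinjlim_j\mathscr C(X_i,Y_j)$. It carries the levelwise structure $\mathrm{Ind}(\mathbb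 T)$: $\mathrm{Ind}(T)(X_i)=(TX_i)$, with the transformations $p,0,+,\ell,c$ applied levelwise. Suppose that $\mathscr C$ has finite products, with terminal object $\top$. Let $I$ be a small filtered category and let $\underline E=(E_i)_{i\in I}$ be an ind-object of $\mathscr C$ together with, for every $i$, a differential bundle structure on the unique map $E_i\to\top$, such that each transition map $E_i\to E_{i'}$ is part of a linear morphism of differential bundles. Then $(\mathrm{Ind}(\mathscr C),\mathrm{Ind}(\mathbb T))$ is a tangent category and $\underline E$ is a differential object in it. -/

import Mathlib

open CategoryTheory CategoryTheory.Limits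

universe w v u v' u' v'' u''

/-! ### Additive bundles -/

/-- The data of an addition and a unit on a bundle `p : A ⟶ M`: a (chosen) fibre square `A₂` of `p`
with its two projections, a map `add : A₂ ⟶ A` and a map `zero : M ⟶ A`. The laws, including the
fact that `A₂` is the pullback `A ×_M A`, are in `AdditiveData.IsAdditive`. -/
structure AdditiveData {C : Type u} [Category.{v} C] {A M : C} (p : A ⟶ M) where
  A₂ : C
  fst : A₂ ⟶ A
  snd : A₂ ⟶ A
  add : A₂ ⟶ A
  zero : M ⟶ A

namespace AdditiveData

variable {C : Type u} [Category.{v} C] {D : Type u'} [Category.{v'} D]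

/-- `p : A ⟶ M` with the given addition and unit is an additive bundle, that is, a commutative
monoid in the slice category over `M`. Associativity is expressed on generalized elements
`x, y, z` of `A` lying in the same fibre. -/
structure IsAdditive {A M : C} {p : A ⟶ M} (S : AdditiveData p) : Prop where
  isPullback : IsPullback S.fst S.snd p p
  add_proj : S.add ≫ p = S.fst ≫ p
  zero_proj : S.zero ≫ p = 𝟙 M
  zero_add : isPullback.lift (p ≫ S.zero) (𝟙 A) (by simp [zero_proj]) ≫ S.add = 𝟙 A
  add_comm : isPullback.lift S.snd S.fst isPullback.w.symm ≫ S.add = S.add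
  add_assoc : ∀ {X : C} (x y z : X ⟶ A) (hxy : x ≫ p = y ≫ p) (hyz : y ≫ p = z ≫ p),
    isPullback.lift (isPullback.lift x y hxy ≫ S.add) z
        (by simp [add_proj, hxy, hyz]) ≫ S.add =
      isPullback.lift x (isPullback.lift y z hyz ≫ S.add)
        (by simp [add_proj, hxy]) ≫ S.add

/-- `(f, g)` is a morphism of additive bundles: it commutes with the bundle maps, with the
additions (where `k` is the map `⟨f ∘ π₀, f ∘ π₁⟩ : A ×_M A ⟶ B ×_N B`), and with the units. -/
structure IsHom {A M B N : C} {p : A ⟶ M} {q : B ⟶ N} (S : AdditiveData p) (R : AdditiveData q)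
    (f : A ⟶ B) (g : M ⟶ N) : Prop where
  comm : f ≫ q = p ≫ g
  add : ∃ k : S.A₂ ⟶ R.A₂, k ≫ R.fst = S.fst ≫ f ∧ k ≫ R.snd = S.snd ≫ f ∧
    S.add ≫ f = k ≫ R.add
  zero : S.zero ≫ f = g ≫ R.zero

/-- The image under a functor. -/
@[simps]
def map (F : C ⥤ D) {A M : C} {p : A ⟶ M} (S : AdditiveData p) : AdditiveData (F.map p) where
  A₂ := F.obj S.A₂
  fst := F.map S.fst
  snd := F.map S.snd
  add := F.map S.add
  zero := F.map S.zero

end AdditiveData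

/-! ### Tangent structures -/

/-- Iterates `T ^ n` of an endofunctor. -/
def CategoryTheory.Functor.power {C : Type u} [Category.{v} C] (T : C ⥤ C) : ℕ → (C ⥤ C)
  | 0 => 𝟭 C
  | n + 1 => T.power n ⋙ T

/-- All pullback powers `A ×_M ⋯ ×_M A` (`n` factors, `n ∈ ℕ`) of `p : A ⟶ M` exist and are
preserved by all the iterates `T ^ m` of the endofunctor `T`. -/
def HasPreservedPowers {C : Type u} [Category.{v} C] (T : C ⥤ C) {A M : C} (p : A ⟶ M) : Prop :=
  ∀ n : ℕ, HasWidePullback M (fun _ : Fin n => A) (fun _ => p) ∧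
    ∀ m : ℕ, PreservesLimit
      (WidePullbackShape.wideCospan M (fun _ : Fin n => A) (fun _ => p)) (T.power m)

/-- The data `(T, p, 0, +, ℓ, c)` of a tangent structure, together with a (chosen) functor `T₂` of
fibre squares of `p` and its projections. The laws are in `TangentData.IsTangent`. -/
structure TangentData (C : Type u) [Category.{v} C] where
  T : C ⥤ C
  p : T ⟶ 𝟭 C
  T₂ : C ⥤ C
  fst : T₂ ⟶ T
  snd : T₂ ⟶ T
  add : T₂ ⟶ T
  zero : 𝟭 C ⟶ T
  /-- the vertical lift `ℓ` -/
  lift : T ⟶ T ⋙ T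
  /-- the canonical flip `c` -/
  flip : T ⋙ T ⟶ T ⋙ T

namespace TangentData

variable {C : Type u} [Category.{v} C] (𝕋 : TangentData C)

/-- The addition and unit on `p_X : T X ⟶ X`. -/
@[simps]
def bundle (X : C) : AdditiveData (C := C) (A := 𝕋.T.obj X) (M := X) (𝕋.p.app X) where
  A₂ := 𝕋.T₂.obj X
  fst := 𝕋.fst.app X
  snd := 𝕋.snd.app X
  add := 𝕋.add.app X
  zero := 𝕋.zero.app X

/-- The axioms of a tangent structure. -/
structure IsTangent : Prop where
  /-- pullback powers of `p_X` exist and are preserved by the iterates of `T` -/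
  powers : ∀ X : C, HasPreservedPowers 𝕋.T (A := 𝕋.T.obj X) (M := X) (𝕋.p.app X)
  /-- `p_X` is an additive bundle with fibre square `T₂ X` -/
  additive : ∀ X : C, (𝕋.bundle X).IsAdditive
  /-- `(ℓ_X, 0_X)` is an additive bundle morphism from `p_X` to `T p_X` -/
  lift_hom : ∀ X : C, (𝕋.bundle X).IsHom ((𝕋.bundle X).map 𝕋.T) (𝕋.lift.app X) (𝕋.zero.app X)
  /-- `(c_X, id)` is an additive bundle morphism from `T p_X` to `p_{T X}` -/
  flip_hom : ∀ X : C, ((𝕋.bundle X).map 𝕋.T).IsHom (𝕋.bundle (𝕋.T.obj X)) (𝕋.flip.app X)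
    (𝟙 (𝕋.T.obj X))
  flip_flip : ∀ X : C, 𝕋.flip.app X ≫ 𝕋.flip.app X = 𝟙 (𝕋.T.obj (𝕋.T.obj X))
  lift_flip : ∀ X : C, 𝕋.lift.app X ≫ 𝕋.flip.app X = 𝕋.lift.app X
  lift_lift : ∀ X : C, 𝕋.lift.app X ≫ 𝕋.T.map (𝕋.lift.app X) =
    𝕋.lift.app X ≫ 𝕋.lift.app (𝕋.T.obj X)
  flip_braid : ∀ X : C,
    𝕋.T.map (𝕋.flip.app X) ≫ 𝕋.flip.app (𝕋.T.obj X) ≫ 𝕋.T.map (𝕋.flip.app X) =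
      𝕋.flip.app (𝕋.T.obj X) ≫ 𝕋.T.map (𝕋.flip.app X) ≫ 𝕋.flip.app (𝕋.T.obj X)
  lift_flip_flip : ∀ X : C,
    𝕋.lift.app (𝕋.T.obj X) ≫ 𝕋.T.map (𝕋.flip.app X) ≫ 𝕋.flip.app (𝕋.T.obj X) =
      𝕋.flip.app X ≫ 𝕋.T.map (𝕋.lift.app X)
  /-- universality of the vertical lift: with `k = ⟨ℓ ∘ π₁, 0_{T X} ∘ π₂⟩ : T₂ X ⟶ T (T₂ X)`, the
  map `T(+) ∘ k` is an equalizer of `T p_X` and `0_X ∘ p_X ∘ p_{T X}` -/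
  universal : ∀ X : C, ∃ k : 𝕋.T₂.obj X ⟶ 𝕋.T.obj (𝕋.T₂.obj X),
    k ≫ 𝕋.T.map (𝕋.fst.app X) = 𝕋.fst.app X ≫ 𝕋.lift.app X ∧
    k ≫ 𝕋.T.map (𝕋.snd.app X) = 𝕋.snd.app X ≫ 𝕋.zero.app (𝕋.T.obj X) ∧
    ∃ e : (k ≫ 𝕋.T.map (𝕋.add.app X)) ≫ 𝕋.T.map (𝕋.p.app X) =
        (k ≫ 𝕋.T.map (𝕋.add.app X)) ≫ 𝕋.p.app (𝕋.T.obj X) ≫ 𝕋.p.app X ≫ 𝕋.zero.app X,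
      Nonempty (IsLimit (Fork.ofι (k ≫ 𝕋.T.map (𝕋.add.app X)) e))

end TangentData

/-! ### Differential bundles and differential objects -/

/-- A differential bundle structure `(σ, ζ, λ)` on `q : E ⟶ M`. -/
structure DifferentialBundle {C : Type u} [Category.{v} C] (𝕋 : TangentData C) {E M : C}
    (q : E ⟶ M) where
  /-- the fibre square `E₂` with its projections, the addition `σ` and the unit `ζ` -/
  str : AdditiveData q
  /-- the lift `λ` -/
  lift : E ⟶ 𝕋.T.obj E
  additive : str.IsAdditive
  powers : HasPreservedPowers 𝕋.T q
  lift_hom_map : str.IsHom (str.map 𝕋.T) lift (𝕋.zero.app M)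
  lift_hom_tangent : str.IsHom (𝕋.bundle E) lift str.zero
  /-- universality of the lift: with `k = ⟨λ ∘ π₀, 0 ∘ π₁⟩ : E₂ ⟶ T (E₂)` and `μ = T(σ) ∘ k`, the
  square with sides `μ`, `q ∘ π₁`, `T q`, `0_M` is a pullback preserved by the iterates of `T` -/
  universal : ∃ k : str.A₂ ⟶ 𝕋.T.obj str.A₂,
    k ≫ 𝕋.T.map str.fst = str.fst ≫ lift ∧
    k ≫ 𝕋.T.map str.snd = str.snd ≫ 𝕋.zero.app E ∧
    ∀ n : ℕ, IsPullback
      ((𝕋.T.power n).map (k ≫ 𝕋.T.map str.add)) ((𝕋.T.power n).map (str.snd ≫ q))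
      ((𝕋.T.power n).map (𝕋.T.map q)) ((𝕋.T.power n).map (𝕋.zero.app M))
  lift_lift : lift ≫ 𝕋.lift.app E = lift ≫ 𝕋.T.map lift

/-- `(f, g)` is a linear morphism of differential bundles: it commutes with the bundle maps and
preserves the lifts. -/
structure DifferentialBundle.IsLinearHom {C : Type u} [Category.{v} C] {𝕋 : TangentData C}
    {E M F N : C} {q : E ⟶ M} {r : F ⟶ N} (P : DifferentialBundle 𝕋 q)
    (Q : DifferentialBundle 𝕋 r) (f : E ⟶ F) (g : M ⟶ N) : Prop where
  comm : f ≫ r = q ≫ g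
  lift : f ≫ Q.lift = P.lift ≫ 𝕋.T.map f

/-- `X` is a differential object: the unique map from `X` to a terminal object underlies a
differential bundle. -/
def IsDifferentialObject {C : Type u} [Category.{v} C] (𝕋 : TangentData C) (X : C) : Prop :=
  ∃ (top : C) (h : IsTerminal top), Nonempty (DifferentialBundle 𝕋 (h.from X))

/-! ### The ind-category -/

/-- An ind-object of `C`: a functor to `C` from a small filtered category. -/
structure IndObj (C : Type u) [Category.{v} C] : Type (max u v (w + 1)) where
  I : Type w
  [cat : SmallCategory I]
  [filtered : IsFiltered I]
  F : I ⥤ C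

namespace IndObj

attribute [instance] IndObj.cat IndObj.filtered

section Germs

variable {C : Type u} [Category.{v} C]

/-- The relation whose generated equivalence relation identifies `f : A ⟶ Y_j` and its composite
with a transition map `Y_j ⟶ Y_{j'}`. -/
def GermRel (A : C) (Y : IndObj.{w} C) (a b : Σ j : Y.I, A ⟶ Y.F.obj j) : Prop :=
  ∃ φ : a.1 ⟶ b.1, b.2 = a.2 ≫ Y.F.map φ

/-- The filtered colimit of sets `colim_j C(A, Y_j)`. -/
def Germ (A : C) (Y : IndObj.{w} C) : Type (max w v) := Quot (GermRel A Y)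

/-- The class of `f : A ⟶ Y_j` in `colim_j C(A, Y_j)`. -/
def germ {A : C} {Y : IndObj.{w} C} (j : Y.I) (f : A ⟶ Y.F.obj j) : Germ A Y := Quot.mk _ ⟨j, f⟩

theorem germ_comp {A : C} {Y : IndObj.{w} C} {j j' : Y.I} (f : A ⟶ Y.F.obj j) (φ : j ⟶ j') :
    germ j' (f ≫ Y.F.map φ) = germ j f :=
  (Quot.sound (r := GermRel A Y) (a := ⟨j, f⟩) (b := ⟨j', f ≫ Y.F.map φ⟩) ⟨φ, rfl⟩).symm

theorem Germ.ind {A : C} {Y : IndObj.{w} C} {P : Germ A Y → Prop}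
    (h : ∀ (j : Y.I) (f : A ⟶ Y.F.obj j), P (germ j f)) (x : Germ A Y) : P x :=
  Quot.ind (fun ⟨j, f⟩ => h j f) x

/-- Precomposition with `h : A ⟶ B`, as a map `colim_j C(B, Y_j) → colim_j C(A, Y_j)`. -/
def Germ.precomp {A B : C} {Y : IndObj.{w} C} (h : A ⟶ B) : Germ B Y → Germ A Y :=
  Quot.lift (fun a => germ a.1 (h ≫ a.2)) (by
    rintro ⟨j, f⟩ ⟨j', f'⟩ ⟨φ, e⟩
    dsimp only at φ e ⊢
    rw [e, ← Category.assoc, germ_comp])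

@[simp]
theorem Germ.precomp_germ {A B : C} {Y : IndObj.{w} C} (h : A ⟶ B) (j : Y.I)
    (f : B ⟶ Y.F.obj j) : Germ.precomp h (germ j f) = germ j (h ≫ f) := rfl

@[simp]
theorem Germ.precomp_id {A : C} {Y : IndObj.{w} C} (x : Germ A Y) : Germ.precomp (𝟙 A) x = x := by
  induction x using Germ.ind with | h j f => simp

theorem Germ.precomp_comp {A B D : C} {Y : IndObj.{w} C} (h : A ⟶ B) (k : B ⟶ D) (x : Germ D Y) :
    Germ.precomp (h ≫ k) x = Germ.precomp h (Germ.precomp k x) := by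
  induction x using Germ.ind with | h j f => simp

/-- The action of a functor, as a map `colim_j C(A, Y_j) → colim_j D(F A, F Y_j)`. -/
def Germ.map {D : Type u'} [Category.{v'} D] (F : C ⥤ D) {A : C} {Y : IndObj.{w} C} :
    Germ A Y → Germ (F.obj A) (IndObj.mk Y.I (Y.F ⋙ F)) :=
  Quot.lift (fun a => germ (Y := IndObj.mk Y.I (Y.F ⋙ F)) a.1 (F.map a.2)) (by
    rintro ⟨j, f⟩ ⟨j', f'⟩ ⟨φ, e⟩
    dsimp only at φ e ⊢
    rw [e, F.map_comp]
    exact (germ_comp (Y := IndObj.mk Y.I (Y.F ⋙ F)) (F.map f) φ).symm)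

@[simp]
theorem Germ.map_germ {D : Type u'} [Category.{v'} D] (F : C ⥤ D) {A : C} {Y : IndObj.{w} C}
    (j : Y.I) (f : A ⟶ Y.F.obj j) :
    Germ.map F (germ j f) = germ (Y := IndObj.mk Y.I (Y.F ⋙ F)) j (F.map f) := rfl

theorem Germ.map_precomp {D : Type u'} [Category.{v'} D] (F : C ⥤ D) {A B : C} {Y : IndObj.{w} C}
    (h : A ⟶ B) (x : Germ B Y) :
    Germ.map F (Germ.precomp h x) = Germ.precomp (F.map h) (Germ.map F x) := by
  induction x using Germ.ind with | h j f => simp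

/-- A morphism of ind-objects: an element of `lim_i colim_j C(X_i, Y_j)`. -/
@[ext]
structure Hom (X Y : IndObj.{w} C) : Type (max w v) where
  app : ∀ i : X.I, Germ (X.F.obj i) Y
  compat : ∀ {i i' : X.I} (φ : i ⟶ i'), Germ.precomp (X.F.map φ) (app i') = app i

/-- Postcomposition with `g : Y ⟶ Z`, as a map `colim_j C(A, Y_j) → colim_k C(A, Z_k)`: the class
of `f : A ⟶ Y_j` is sent to the class of `g_j ∘ f`. -/
def Germ.postcomp {A : C} {Y Z : IndObj.{w} C} (g : Hom Y Z) : Germ A Y → Germ A Z :=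
  Quot.lift (fun a => Germ.precomp a.2 (g.app a.1)) (by
    rintro ⟨j, f⟩ ⟨j', f'⟩ ⟨φ, e⟩
    dsimp only at φ e ⊢
    rw [e, Germ.precomp_comp, g.compat])

@[simp]
theorem Germ.postcomp_germ {A : C} {Y Z : IndObj.{w} C} (g : Hom Y Z) (j : Y.I)
    (f : A ⟶ Y.F.obj j) : Germ.postcomp g (germ j f) = Germ.precomp f (g.app j) := rfl

theorem Germ.postcomp_precomp {A B : C} {Y Z : IndObj.{w} C} (g : Hom Y Z) (h : A ⟶ B)
    (x : Germ B Y) : Germ.postcomp g (Germ.precomp h x) = Germ.precomp h (Germ.postcomp g x) := by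
  induction x using Germ.ind with | h j f => simp [Germ.precomp_comp]

/-- The ind-category `Ind(C)`. -/
instance : Category.{max w v} (IndObj.{w} C) where
  Hom X Y := Hom X Y
  id X :=
    { app := fun i => germ i (𝟙 (X.F.obj i))
      compat := fun {i i'} φ => by
        rw [Germ.precomp_germ, Category.comp_id, ← germ_comp (𝟙 _) φ, Category.id_comp] }
  comp {X Y Z} f g :=
    { app := fun i => Germ.postcomp g (f.app i)
      compat := fun φ => by rw [← Germ.postcomp_precomp, f.compat] }
  id_comp f := by
    apply Hom.ext; funext i
    simp
  comp_id {X Y} f := by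
    apply Hom.ext; funext i
    dsimp only
    induction f.app i using Germ.ind with | h j f => simp
  assoc {W X Y Z} f g h := by
    apply Hom.ext; funext i
    dsimp only
    induction f.app i using Germ.ind with | h j f => simp [Germ.postcomp_precomp]

theorem hom_ext {X Y : IndObj.{w} C} {f g : X ⟶ Y} (h : ∀ i, Hom.app f i = Hom.app g i) : f = g :=
  Hom.ext (funext h)

@[simp]
theorem id_app (X : IndObj.{w} C) (i : X.I) : Hom.app (𝟙 X) i = germ i (𝟙 (X.F.obj i)) := rfl

@[simp]
theorem comp_app {X Y Z : IndObj.{w} C} (f : X ⟶ Y) (g : Y ⟶ Z) (i : X.I) :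
    Hom.app (f ≫ g) i = Germ.postcomp g (Hom.app f i) := rfl

end Germs

section Functoriality

variable {C : Type u} [Category.{v} C] {D : Type u'} [Category.{v'} D]

/-- A natural transformation of diagrams of the same shape, as a morphism of ind-objects. -/
def ofNatTrans {I : Type w} [SmallCategory I] [IsFiltered I] {X Y : I ⥤ C} (α : X ⟶ Y) :
    IndObj.mk I X ⟶ IndObj.mk I Y where
  app i := germ (Y := IndObj.mk I Y) i (α.app i)
  compat {i i'} φ := by
    have h := germ_comp (Y := IndObj.mk I Y) (α.app i) φ
    rw [← h]
    exact congrArg (germ (Y := IndObj.mk I Y) i') (α.naturality φ)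

/-- The action of `F` on a morphism of ind-objects, induced by the maps
`colim_j C(X_i, Y_j) → colim_j D(F X_i, F Y_j)`. -/
def Hom.map (F : C ⥤ D) {X Y : IndObj.{w} C} (f : Hom X Y) :
    Hom (IndObj.mk X.I (X.F ⋙ F)) (IndObj.mk Y.I (Y.F ⋙ F)) where
  app i := Germ.map F (f.app i)
  compat {i i'} φ := by
    rw [← f.compat φ, Germ.map_precomp]
    rfl

theorem Germ.map_postcomp (F : C ⥤ D) {A : C} {Y Z : IndObj.{w} C} (g : Hom Y Z) (x : Germ A Y) :
    Germ.map F (Germ.postcomp g x) = Germ.postcomp (Hom.map F g) (Germ.map F x) := by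
  induction x using Germ.ind with
  | h j f => exact Germ.map_precomp F f (g.app j)

/-- The functor `Ind(F) : Ind(C) ⥤ Ind(D)`, with `Ind(F)(X_i) = (F X_i)`. -/
def mapFunctor (F : C ⥤ D) : IndObj.{w} C ⥤ IndObj.{w} D where
  obj X := IndObj.mk X.I (X.F ⋙ F)
  map f := Hom.map F f
  map_id X := by
    apply hom_ext; intro i
    exact congrArg (germ (Y := IndObj.mk X.I (X.F ⋙ F)) i) (F.map_id (X.F.obj i))
  map_comp {X Y Z} f g := by
    apply hom_ext; intro i
    exact Germ.map_postcomp F g (Hom.app f i)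

/-- The natural transformation `Ind(α) : Ind(F) ⟶ Ind(G)`, with components `(α_{X_i})`. -/
def mapNatTrans {F G : C ⥤ D} (α : F ⟶ G) :
    (mapFunctor F : IndObj.{w} C ⥤ IndObj.{w} D) ⟶ mapFunctor G where
  app X := ofNatTrans (Functor.whiskerLeft X.F α)
  naturality X Y f := by
    apply hom_ext; intro i
    have h (x : Germ (X.F.obj i) Y) :
        Germ.postcomp (ofNatTrans (Functor.whiskerLeft Y.F α)) (Germ.map F x) =
          Germ.precomp (α.app (X.F.obj i)) (Germ.map G x) := by
      induction x using Germ.ind with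
      | h j f =>
        exact congrArg (germ (Y := IndObj.mk Y.I (Y.F ⋙ G)) j) (α.naturality f)
    exact h (Hom.app f i)

theorem mapFunctor_id_map {X Y : IndObj.{w} C} (f : X ⟶ Y) : (mapFunctor (𝟭 C)).map f = f := by
  apply hom_ext; intro i
  have h (x : Germ (X.F.obj i) Y) : Germ.map (𝟭 C) x = x := by
    induction x using Germ.ind with | h j f => rfl
  exact h (Hom.app f i)

theorem mapFunctor_comp_map {B : Type u''} [Category.{v''} B] (F : C ⥤ D) (G : D ⥤ B)
    {X Y : IndObj.{w} C} (f : X ⟶ Y) :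
    (mapFunctor (F ⋙ G)).map f = (mapFunctor G).map ((mapFunctor F).map f) := by
  apply hom_ext; intro i
  have h (x : Germ (X.F.obj i) Y) : Germ.map (F ⋙ G) x = Germ.map G (Germ.map F x) := by
    induction x using Germ.ind with | h j f => rfl
  exact h (Hom.app f i)

/-- The identification `Ind(id) = id`. -/
def mapId : (mapFunctor (𝟭 C) : IndObj.{w} C ⥤ IndObj.{w} C) ≅ 𝟭 (IndObj.{w} C) :=
  NatIso.ofComponents (fun X => Iso.refl X) (fun f =>
    (Category.comp_id _).trans ((mapFunctor_id_map f).trans (Category.id_comp f).symm))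

/-- The compositor `Ind(F ⋙ G) ≅ Ind(F) ⋙ Ind(G)`. -/
def mapComp {B : Type u''} [Category.{v''} B] (F : C ⥤ D) (G : D ⥤ B) :
    (mapFunctor (F ⋙ G) : IndObj.{w} C ⥤ IndObj.{w} B) ≅ mapFunctor F ⋙ mapFunctor G :=
  NatIso.ofComponents (fun X => Iso.refl ((mapFunctor G).obj ((mapFunctor F).obj X))) (fun f =>
    (Category.comp_id _).trans ((mapFunctor_comp_map F G f).trans (Category.id_comp _).symm))

end Functoriality

end IndObj

/-- The ind-tangent structure `Ind(𝕋)` on `Ind(C)`: everything is given levelwise. -/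
def TangentData.ind {C : Type u} [Category.{v} C] (𝕋 : TangentData C) :
    TangentData (IndObj.{w} C) where
  T := IndObj.mapFunctor 𝕋.T
  p := IndObj.mapNatTrans 𝕋.p ≫ IndObj.mapId.hom
  T₂ := IndObj.mapFunctor 𝕋.T₂
  fst := IndObj.mapNatTrans 𝕋.fst
  snd := IndObj.mapNatTrans 𝕋.snd
  add := IndObj.mapNatTrans 𝕋.add
  zero := IndObj.mapId.inv ≫ IndObj.mapNatTrans 𝕋.zero
  lift := IndObj.mapNatTrans 𝕋.lift ≫ (IndObj.mapComp 𝕋.T 𝕋.T).hom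
  flip := (IndObj.mapComp 𝕋.T 𝕋.T).inv ≫ IndObj.mapNatTrans 𝕋.flip ≫
    (IndObj.mapComp 𝕋.T 𝕋.T).hom

/-! ### Germs and levelwise finite limits in the ind-category -/

namespace IndObj

variable {C : Type u} [Category.{v} C]

/-! In a filtered colimit of sets, finitely many elements are represented at one common index, and
finitely many equations between them hold at a later one. Consequently the functor `ofDiagram`, from
`I`-shaped diagrams to ind-objects, sends levelwise finite limits to limits
(`isLimitOfDiagramMapCone`). Every ind-object is such a diagram, and `Ind(T)` and its iterates act
levelwise on diagrams. Each tangent axiom is either an equation between natural maps or a statement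
about a finite limit (fibre powers, the equalizer for the vertical lift), possibly preserved by
iterates of `T`, so it passes from the levels to the ind-category.

The same transfer turns an `I`-shaped diagram of differential bundles into a differential bundle,
provided that lifts, additions and units are all natural in `I`. Linearity supplies naturality of
the lifts only. The rest comes from `IsLinearHom.isHom`: linear morphisms are automatically
additive. Indeed `λ` is a monomorphism (`mono_lift`) and is additive into the tangent bundle, whose
addition is natural; the unit is recovered from `p ∘ λ = ζ ∘ q`. Finally, the base is the constant
diagram on `⊤`, which is terminal in the ind-category. -/

theorem germ_eq_iff {A : C} {Y : IndObj.{w} C} {j j' : Y.I} (f : A ⟶ Y.F.obj j)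
    (g : A ⟶ Y.F.obj j') :
    germ j f = germ j' g ↔
      ∃ (k : Y.I) (φ : j ⟶ k) (ψ : j' ⟶ k), f ≫ Y.F.map φ = g ≫ Y.F.map ψ := by
  constructor
  · intro h
    have key : ∀ a b : Σ j : Y.I, A ⟶ Y.F.obj j, Relation.EqvGen (GermRel A Y) a b →
        ∃ (k : Y.I) (φ : a.1 ⟶ k) (ψ : b.1 ⟶ k), a.2 ≫ Y.F.map φ = b.2 ≫ Y.F.map ψ := by
      intro a b hab
      induction hab with
      | rel a b h =>
        obtain ⟨φ, e⟩ := h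
        exact ⟨b.1, φ, 𝟙 _, by simp [e]⟩
      | refl a => exact ⟨a.1, 𝟙 _, 𝟙 _, rfl⟩
      | symm a b _ ih =>
        obtain ⟨k, φ, ψ, e⟩ := ih
        exact ⟨k, ψ, φ, e.symm⟩
      | trans a b c _ _ ih₁ ih₂ =>
        obtain ⟨k, φ, ψ, e⟩ := ih₁
        obtain ⟨k', φ', ψ', e'⟩ := ih₂
        -- Transitivity is where filteredness enters: the two maps out of the middle index are
        -- completed to a commuting square.
        obtain ⟨l, r, s, hrs⟩ := IsFiltered.span ψ φ'
        refine ⟨l, φ ≫ r, ψ' ≫ s, ?_⟩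
        rw [Functor.map_comp, Functor.map_comp, reassoc_of% e, ← reassoc_of% e',
          ← Functor.map_comp, ← Functor.map_comp, hrs]
    exact key ⟨j, f⟩ ⟨j', g⟩ (Quot.eqvGen_exact h)
  · rintro ⟨k, φ, ψ, e⟩
    rw [← germ_comp f φ, ← germ_comp g ψ, e]

/-- Both representatives live at the same index, so the two legs given by `germ_eq_iff` are parallel
and can be coequalized into a single transition map. -/
theorem exists_comp_map_eq {A : C} {Y : IndObj.{w} C} {j : Y.I} {f g : A ⟶ Y.F.obj j}
    (h : germ j f = germ j g) : ∃ (k : Y.I) (φ : j ⟶ k), f ≫ Y.F.map φ = g ≫ Y.F.map φ := by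
  obtain ⟨k, φ, ψ, e⟩ := (germ_eq_iff f g).1 h
  refine ⟨IsFiltered.coeq φ ψ, φ ≫ IsFiltered.coeqHom φ ψ, ?_⟩
  conv_rhs => rw [IsFiltered.coeq_condition]
  simp only [Functor.map_comp, reassoc_of% e]

section Levelwise

variable {I : Type w} [SmallCategory I] [IsFiltered I]

/-- Finitely many germs along diagrams of the same shape are represented at a common index. -/
theorem exists_germ_eq {A : C} {ι : Type*} [Finite ι] (X : ι → I ⥤ C)
    (x : ∀ k, Germ A (IndObj.mk I (X k))) :
    ∃ (i : I) (f : ∀ k, A ⟶ (X k).obj i), ∀ k, germ (Y := IndObj.mk I (X k)) i (f k) = x k := by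
  classical
  have := Fintype.ofFinite ι
  have h : ∀ k, ∃ (i : I) (f : A ⟶ (X k).obj i), germ (Y := IndObj.mk I (X k)) i f = x k :=
    fun k => Germ.ind (P := fun x => ∃ (i : I) (f : A ⟶ (X k).obj i),
      germ (Y := IndObj.mk I (X k)) i f = x) (fun i f => ⟨i, f, rfl⟩) (x k)
  choose i f hf using h
  obtain ⟨s, hs⟩ := IsFiltered.sup_objs_exists (Finset.univ.image i)
  have φ : ∀ k, i k ⟶ s := fun k => (hs (Finset.mem_image_of_mem i (Finset.mem_univ k))).some
  exact ⟨s, fun k => f k ≫ (X k).map (φ k), fun k =>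
    (germ_comp (Y := IndObj.mk I (X k)) (f k) (φ k)).trans (hf k)⟩

/-- Finitely many equalities of germs hold at a common later index. -/
theorem exists_comp_map_eq_of_finite {A : C} {ι : Type*} [Finite ι] (X : ι → I ⥤ C) {i : I}
    (f g : ∀ k, A ⟶ (X k).obj i)
    (h : ∀ k, germ (Y := IndObj.mk I (X k)) i (f k) = germ (Y := IndObj.mk I (X k)) i (g k)) :
    ∃ (j : I) (φ : i ⟶ j), ∀ k, f k ≫ (X k).map φ = g k ≫ (X k).map φ := by
  classical
  have := Fintype.ofFinite ι
  suffices ∀ s : Finset ι, ∃ (j : I) (φ : i ⟶ j), ∀ k ∈ s, f k ≫ (X k).map φ = g k ≫ (X k).map φ by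
    obtain ⟨j, φ, e⟩ := this Finset.univ
    exact ⟨j, φ, fun k => e k (Finset.mem_univ k)⟩
  intro s
  induction s using Finset.induction_on with
  | empty => exact ⟨i, 𝟙 i, by simp⟩
  | insert a s _ ih =>
    obtain ⟨j, φ, e⟩ := ih
    obtain ⟨j', φ', e'⟩ := exists_comp_map_eq (h a)
    obtain ⟨l, r, t, hrt⟩ := IsFiltered.span φ φ'
    refine ⟨l, φ ≫ r, fun k hk => ?_⟩
    rcases Finset.mem_insert.1 hk with rfl | hk
    · rw [hrt]
      simpa using congrArg (· ≫ (X k).map t) e'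
    · simpa using congrArg (· ≫ (X k).map r) (e k hk)

/-- The functor sending a diagram of shape `I` to the ind-object it defines. -/
def ofDiagram (I : Type w) [SmallCategory I] [IsFiltered I] (C : Type u) [Category.{v} C] :
    (I ⥤ C) ⥤ IndObj.{w} C where
  obj X := IndObj.mk I X
  map α := ofNatTrans α
  map_id _ := rfl
  map_comp _ _ := rfl

theorem ofNatTrans_comp {X Y Z : I ⥤ C} (α : X ⟶ Y) (β : Y ⟶ Z) :
    ofNatTrans (α ≫ β) = ofNatTrans α ≫ ofNatTrans β := rfl

theorem ofNatTrans_congr {X Y : I ⥤ C} {α β : X ⟶ Y} (h : ∀ i, α.app i = β.app i) :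
    ofNatTrans α = ofNatTrans β :=
  congrArg ofNatTrans (NatTrans.ext (funext h))

end Levelwise

end IndObj

namespace IndObj

variable {C : Type u} [Category.{v} C] {D : Type u'} [Category.{v'} D]

/-! ### Finite limits of diagrams computed levelwise. -/

section Limits

variable {I : Type w} [SmallCategory I] [IsFiltered I]
variable {J : Type} [SmallCategory J] [FinCategory J] {K : J ⥤ I ⥤ C} {c : Cone K}

/-- Injectivity half of the commutation of finite limits with filtered colimits: the finitely many
equalities of projections hold at one index, where the limit cone is jointly monic. -/
theorem germ_ext_of_isLimit (hc : ∀ i, IsLimit (((evaluation I C).obj i).mapCone c)) {A : C}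
    {x y : Germ A (IndObj.mk I c.pt)}
    (h : ∀ j, Germ.postcomp (ofNatTrans (c.π.app j)) x = Germ.postcomp (ofNatTrans (c.π.app j)) y) :
    x = y := by
  obtain ⟨i, f, hf⟩ := exists_germ_eq (fun _ : Bool => c.pt) (fun b => cond b x y)
  obtain rfl := hf true
  obtain rfl := hf false
  obtain ⟨k, φ, e⟩ := exists_comp_map_eq_of_finite (fun j => K.obj j)
    (fun j => f true ≫ (c.π.app j).app i) (fun j => f false ≫ (c.π.app j).app i) h
  refine (germ_eq_iff _ _).2 ⟨k, φ, φ, (hc k).hom_ext fun j => ?_⟩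
  simpa using e j

/-- Surjectivity half: a compatible family of germs becomes a genuine cone at some index, and lifts
there. -/
theorem exists_germ_of_isLimit (hc : ∀ i, IsLimit (((evaluation I C).obj i).mapCone c)) {A : C}
    (x : ∀ j, Germ A (IndObj.mk I (K.obj j)))
    (hx : ∀ {j j' : J} (a : j ⟶ j'), Germ.postcomp (ofNatTrans (K.map a)) (x j) = x j') :
    ∃ y : Germ A (IndObj.mk I c.pt), ∀ j, Germ.postcomp (ofNatTrans (c.π.app j)) y = x j := by
  obtain ⟨i, f, hf⟩ := exists_germ_eq (fun j => K.obj j) x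
  obtain ⟨k, φ, e⟩ := exists_comp_map_eq_of_finite
    -- One equation per arrow of `J`; finiteness of the set of arrows makes them hold
    -- simultaneously.
    (ι := Σ p : J × J, p.1 ⟶ p.2) (fun a => K.obj a.1.2)
    (fun a => f a.1.1 ≫ (K.map a.2).app i) (fun a => f a.1.2) (by
      rintro ⟨⟨j, j'⟩, a⟩
      refine Eq.trans ?_ ((hx a).trans (hf j').symm)
      rw [← hf j]
      rfl)
  let s : Cone (K ⋙ (evaluation I C).obj k) :=
    { pt := A
      π :=
        { app := fun j => f j ≫ (K.obj j).map φ
          naturality := fun j j' a => by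
            have := e ⟨(j, j'), a⟩
            simpa using this.symm } }
  refine ⟨germ (Y := IndObj.mk I c.pt) k ((hc k).lift s), fun j => ?_⟩
  have h₁ : (hc k).lift s ≫ (c.π.app j).app k = f j ≫ (K.obj j).map φ := (hc k).fac s j
  rw [← hf j, ← germ_comp (Y := IndObj.mk I (K.obj j)) (f j) φ]
  exact congrArg (germ (Y := IndObj.mk I (K.obj j)) k) h₁

/-- Levelwise finite limits are limits in the ind-category. -/
noncomputable def isLimitOfDiagramMapCone (hc : ∀ i, IsLimit (((evaluation I C).obj i).mapCone c)) :
    IsLimit ((ofDiagram I C).mapCone c) := by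
  refine IsLimit.ofExistsUnique fun s => ?_
  have h : ∀ i : s.pt.I, ∃ y : Germ (s.pt.F.obj i) (IndObj.mk I c.pt),
      ∀ j, Germ.postcomp (ofNatTrans (c.π.app j)) y = Hom.app (s.π.app j) i := fun i =>
    exists_germ_of_isLimit hc (fun j => (show Hom s.pt (IndObj.mk I (K.obj j)) from s.π.app j).app i)
      fun a => congrArg (fun t => Hom.app t i) (s.w a)
  choose y hy using h
  -- The germs `y i` are chosen independently for each `i`; compatibility with transition maps and
  -- uniqueness both follow from joint injectivity of the projections.
  refine ⟨(⟨y, fun {i i'} φ => germ_ext_of_isLimit hc fun j => ?_⟩ : Hom s.pt (IndObj.mk I c.pt)),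
    fun j => hom_ext fun i => hy i j, fun m hm => hom_ext fun i => germ_ext_of_isLimit hc fun j => ?_⟩
  · rw [Germ.postcomp_precomp, hy, hy]
    exact Hom.compat (s.π.app j) φ
  · exact (congrArg (fun t => Hom.app t i) (hm j)).trans (hy i j).symm

end Limits

section Iterates

variable (I : Type w) [SmallCategory I] [IsFiltered I]

/-- The functor `Ind(F)` is given levelwise on diagrams. -/
def ofDiagramCompMapFunctor (F : C ⥤ D) :
    ofDiagram I C ⋙ mapFunctor F ≅ (Functor.whiskeringRight I C D).obj F ⋙ ofDiagram I D :=
  Iso.refl _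

/-- The iterates of `Ind(T)` are given levelwise on diagrams. -/
def ofDiagramCompPower (T : C ⥤ C) : ∀ n : ℕ,
    ofDiagram I C ⋙ (mapFunctor T).power n ≅
      (Functor.whiskeringRight I C C).obj (T.power n) ⋙ ofDiagram I C
  | 0 => Iso.refl _
  | n + 1 =>
    Functor.isoWhiskerRight (ofDiagramCompPower T n) (mapFunctor T) ≪≫
      Functor.isoWhiskerLeft ((Functor.whiskeringRight I C C).obj (T.power n))
        (ofDiagramCompMapFunctor I T)

end Iterates

/-! ### Preservation of levelwise limits. -/

section Preservation

variable {I : Type w} [SmallCategory I] [IsFiltered I]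
variable {J : Type} [SmallCategory J] [FinCategory J] {K : J ⥤ I ⥤ C} {c : Cone K}

/-- A functor given levelwise by `F` preserves the levelwise finite limits which `F` preserves. -/
noncomputable def isLimitMapConeOfLevelwise {F : C ⥤ D} {G : IndObj.{w} C ⥤ IndObj.{w} D}
    (e : ofDiagram I C ⋙ G ≅ (Functor.whiskeringRight I C D).obj F ⋙ ofDiagram I D)
    (hc : ∀ i, IsLimit (F.mapCone (((evaluation I C).obj i).mapCone c))) :
    IsLimit (G.mapCone ((ofDiagram I C).mapCone c)) := by
  have h : IsLimit ((ofDiagram I D).mapCone (((Functor.whiskeringRight I C D).obj F).mapCone c)) :=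
    isLimitOfDiagramMapCone fun i => hc i
  exact (IsLimit.mapConeEquiv e.symm (c := c) h :)

end Preservation

theorem isPullback_ofNatTrans {I : Type w} [SmallCategory I] [IsFiltered I] {P X Y Z : I ⥤ C}
    {a : P ⟶ X} {b : P ⟶ Y} {f : X ⟶ Z} {g : Y ⟶ Z}
    (h : ∀ i, IsPullback (a.app i) (b.app i) (f.app i) (g.app i)) :
    IsPullback (ofNatTrans a) (ofNatTrans b) (ofNatTrans f) (ofNatTrans g) := by
  have w : a ≫ f = b ≫ g := NatTrans.ext (funext fun i => (h i).w)
  refine ⟨⟨congrArg ofNatTrans w⟩, ⟨?_⟩⟩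
  refine isLimitMapConePullbackConeEquiv (ofDiagram I C) w (isLimitOfDiagramMapCone fun i => ?_)
  exact (isLimitMapConePullbackConeEquiv ((evaluation I C).obj i) w).symm (h i).isLimit

theorem germ_ext_of_isPullback {I : Type w} [SmallCategory I] [IsFiltered I] {P X Y Z : I ⥤ C}
    {a : P ⟶ X} {b : P ⟶ Y} {f : X ⟶ Z} {g : Y ⟶ Z}
    (h : ∀ i, IsPullback (a.app i) (b.app i) (f.app i) (g.app i)) {A : C}
    {x y : Germ A (IndObj.mk I P)}
    (hX : Germ.postcomp (ofNatTrans a) x = Germ.postcomp (ofNatTrans a) y)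
    (hY : Germ.postcomp (ofNatTrans b) x = Germ.postcomp (ofNatTrans b) y) : x = y := by
  obtain ⟨i, f, hf⟩ := exists_germ_eq (fun _ : Bool => P) (fun b => cond b x y)
  obtain rfl := hf true
  obtain rfl := hf false
  obtain ⟨k, φ, e⟩ := exists_comp_map_eq_of_finite
    (fun t : Bool => cond t X Y)
    (fun t => match t with | true => f true ≫ a.app i | false => f true ≫ b.app i)
    (fun t => match t with | true => f false ≫ a.app i | false => f false ≫ b.app i)
    (fun t => match t with | true => hX | false => hY)
  refine (germ_eq_iff _ _).2 ⟨k, φ, φ, (h k).hom_ext ?_ ?_⟩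
  · simpa using e true
  · simpa using e false

/-- A morphism into a levelwise pullback is represented by the levelwise lift of representatives. -/
theorem app_lift_eq_germ {I : Type w} [SmallCategory I] [IsFiltered I] {P X Y Z : I ⥤ C}
    {a : P ⟶ X} {b : P ⟶ Y} {f : X ⟶ Z} {g : Y ⟶ Z}
    (h : ∀ i, IsPullback (a.app i) (b.app i) (f.app i) (g.app i))
    (h' : IsPullback (ofNatTrans a) (ofNatTrans b) (ofNatTrans f) (ofNatTrans g))
    {W : IndObj.{w} C} (x : W ⟶ IndObj.mk I X) (y : W ⟶ IndObj.mk I Y)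
    (e : x ≫ ofNatTrans f = y ≫ ofNatTrans g) {k : W.I} {i : I} (m : W.F.obj k ⟶ P.obj i)
    (hx : Hom.app x k = germ (Y := IndObj.mk I X) i (m ≫ a.app i))
    (hy : Hom.app y k = germ (Y := IndObj.mk I Y) i (m ≫ b.app i)) :
    Hom.app (h'.lift x y e) k = germ (Y := IndObj.mk I P) i m := by
  refine germ_ext_of_isPullback h ?_ ?_
  · exact (congrArg (fun t => Hom.app t k) (h'.lift_fst x y e)).trans hx
  · exact (congrArg (fun t => Hom.app t k) (h'.lift_snd x y e)).trans hy

/-- Stated up to the isomorphism `e` so as to apply to iterates of `Ind(T)`, which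
`ofDiagramCompPower` compares with levelwise iterates by recursion. -/
theorem isPullback_map_of_levelwise {I : Type w} [SmallCategory I] [IsFiltered I]
    {F : C ⥤ D} {G : IndObj.{w} C ⥤ IndObj.{w} D}
    (e : ofDiagram I C ⋙ G ≅ (Functor.whiskeringRight I C D).obj F ⋙ ofDiagram I D)
    {P X Y Z : I ⥤ C} {a : P ⟶ X} {b : P ⟶ Y} {f : X ⟶ Z} {g : Y ⟶ Z}
    (h : ∀ i, IsPullback (F.map (a.app i)) (F.map (b.app i)) (F.map (f.app i)) (F.map (g.app i))) :
    IsPullback (G.map (ofNatTrans a)) (G.map (ofNatTrans b)) (G.map (ofNatTrans f))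
      (G.map (ofNatTrans g)) :=
  IsPullback.of_iso
    (isPullback_ofNatTrans (a := Functor.whiskerRight a F) (b := Functor.whiskerRight b F)
      (f := Functor.whiskerRight f F) (g := Functor.whiskerRight g F) h)
    (e.symm.app P) (e.symm.app X) (e.symm.app Y) (e.symm.app Z)
    (e.symm.hom.naturality a) (e.symm.hom.naturality b) (e.symm.hom.naturality f)
    (e.symm.hom.naturality g)

end IndObj

/-! ### Pullback powers -/

section Powers

variable {C : Type u} [Category.{v} C]

/-- A functor which preserves the limit of the cospan `p, p`, as a wide pullback, preserves any
fibre square of `p`. -/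
theorem CategoryTheory.IsPullback.map_of_preservesLimit_wideCospan {D : Type u'} [Category.{v'} D]
    (F : C ⥤ D) {P A M : C} {a b : P ⟶ A} {p : A ⟶ M} (h : IsPullback a b p p)
    [PreservesLimit (WidePullbackShape.wideCospan M (fun _ : Fin 2 => A) (fun _ => p)) F] :
    IsPullback (F.map a) (F.map b) (F.map p) (F.map p) := by
  let c : Cone (WidePullbackShape.wideCospan M (fun _ : Fin 2 => A) (fun _ => p)) :=
    WidePullbackShape.mkCone (a ≫ p) (fun j => match j with | 0 => a | 1 => b)
      (fun j => match j with | 0 => rfl | 1 => h.w.symm)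
  have hc : IsLimit c := IsLimit.ofExistsUnique fun s => by
    have e : ∀ j, s.π.app (some j) ≫ p = s.π.app none := fun j =>
      s.w (WidePullbackShape.Hom.term j)
    refine ⟨h.lift (s.π.app (some 0)) (s.π.app (some 1)) ((e 0).trans (e 1).symm), ?_, ?_⟩
    · rintro (_ | j)
      · exact (h.lift_fst_assoc _ _ _ _).trans (e 0)
      · match j with
        | 0 => exact h.lift_fst _ _ _
        | 1 => exact h.lift_snd _ _ _
    · intro m hm
      exact h.hom_ext ((hm (some 0)).trans (h.lift_fst _ _ _).symm)
        ((hm (some 1)).trans (h.lift_snd _ _ _).symm)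
  have hF : IsLimit (F.mapCone c) := isLimitOfPreserves F hc
  -- Converts an ordinary pullback cone over `F p, F p` into a wide one, so that the universal
  -- property of `hF` applies to it.
  let t (s : PullbackCone (F.map p) (F.map p)) :
      Cone (WidePullbackShape.wideCospan M (fun _ : Fin 2 => A) (fun _ => p) ⋙ F) :=
    WidePullbackShape.mkCone (s.fst ≫ F.map p) (fun j => match j with | 0 => s.fst | 1 => s.snd)
      (fun j => match j with | 0 => rfl | 1 => s.condition.symm)
  refine ⟨⟨by rw [← F.map_comp, h.w, F.map_comp]⟩, ⟨PullbackCone.IsLimit.mk _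
    (fun s => hF.lift (t s)) (fun s => hF.fac (t s) (some 0)) (fun s => hF.fac (t s) (some 1))
    (fun s m h₁ h₂ => ?_)⟩⟩
  refine hF.hom_ext fun j => Eq.trans ?_ (hF.fac (t s) j).symm
  rcases j with _ | j
  · refine Eq.trans ?_ (congrArg (· ≫ F.map p) h₁)
    exact (congrArg (m ≫ ·) (F.map_comp a p)).trans (Category.assoc _ _ _).symm
  · match j with
    | 0 => exact h₁
    | 1 => exact h₂

theorem HasPreservedPowers.isPullback_map_power {T : C ⥤ C} {P A M : C} {a b : P ⟶ A} {p : A ⟶ M}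
    (hp : HasPreservedPowers T p) (h : IsPullback a b p p) (n : ℕ) :
    IsPullback ((T.power n).map a) ((T.power n).map b) ((T.power n).map p) ((T.power n).map p) := by
  have := (hp 2).2 n
  exact h.map_of_preservesLimit_wideCospan (T.power n)

theorem HasPreservedPowers.isPullback_map {T : C ⥤ C} {P A M : C} {a b : P ⟶ A} {p : A ⟶ M}
    (hp : HasPreservedPowers T p) (h : IsPullback a b p p) :
    IsPullback (T.map a) (T.map b) (T.map p) (T.map p) :=
  -- `T.power 1` is `𝟭 C ⋙ T`, which acts definitionally as `T`.
  hp.isPullback_map_power h 1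

namespace IndObj

variable {I : Type w} [SmallCategory I] [IsFiltered I]

/-- A fibre power over `Fin n` is a finite limit, so chosen limit cones at the levels assemble into
a cone of diagrams that remains limiting in the ind-category; its preservation is again checked at
each level. -/
theorem hasPreservedPowers_ofNatTrans {T : C ⥤ C} {X M : I ⥤ C} (α : X ⟶ M)
    (h : ∀ i, HasPreservedPowers T (α.app i)) :
    HasPreservedPowers (mapFunctor T) (ofNatTrans α) := by
  intro n
  let K : WidePullbackShape (Fin n) ⥤ I ⥤ C :=
    WidePullbackShape.wideCospan M (fun _ => X) (fun _ => α)
  let e (i : I) : K.flip.obj i ≅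
      WidePullbackShape.wideCospan (M.obj i) (fun _ : Fin n => X.obj i) (fun _ => α.app i) :=
    WidePullbackShape.diagramIsoWideCospan _
  have hlim (i : I) : HasLimit (K.flip.obj i) :=
    have : HasLimit (WidePullbackShape.wideCospan (M.obj i) (fun _ : Fin n => X.obj i)
      (fun _ => α.app i)) := (h i n).1
    hasLimit_of_iso (e i).symm
  let c : Cone K := combineCones K fun i => getLimitCone (K.flip.obj i)
  have hc (i : I) : IsLimit (((evaluation I C).obj i).mapCone c) :=
    IsLimit.ofIsoLimit (getLimitCone (K.flip.obj i)).isLimit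
      (evaluateCombinedCones K (fun i => getLimitCone (K.flip.obj i)) i).symm
  let e' : K ⋙ ofDiagram I C ≅ WidePullbackShape.wideCospan (IndObj.mk I M)
      (fun _ : Fin n => IndObj.mk I X) (fun _ => ofNatTrans α) :=
    WidePullbackShape.diagramIsoWideCospan _
  refine ⟨?_, fun m => ?_⟩
  · have : HasLimit (K ⋙ ofDiagram I C) := ⟨⟨_, isLimitOfDiagramMapCone hc⟩⟩
    exact hasLimit_of_iso e'
  · have : PreservesLimit (K ⋙ ofDiagram I C) ((mapFunctor T).power m) := by
      refine preservesLimit_of_preserves_limit_cone (isLimitOfDiagramMapCone hc)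
        -- Preservation need only be tested on the one levelwise limit cone.
        (isLimitMapConeOfLevelwise (ofDiagramCompPower I T m) fun i => ?_)
      have : PreservesLimit (K ⋙ (evaluation I C).obj i) (T.power m) :=
        have := (h i n).2 m
        preservesLimit_of_iso_diagram _ (show _ ≅ K ⋙ (evaluation I C).obj i from (e i).symm)
      exact isLimitOfPreserves (T.power m) (hc i)
    exact preservesLimit_of_iso_diagram _ e'

end IndObj

end Powers

/-! ### Levelwise additive bundles -/

section LevelwiseAdditive

variable {C : Type u} [Category.{v} C]

theorem CategoryTheory.IsPullback.of_forall_app {I : Type u'} [Category.{v'} I] {P X Y Z : I ⥤ C}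
    {a : P ⟶ X} {b : P ⟶ Y} {f : X ⟶ Z} {g : Y ⟶ Z}
    (h : ∀ i, IsPullback (a.app i) (b.app i) (f.app i) (g.app i)) : IsPullback a b f g := by
  have w : a ≫ f = b ≫ g := NatTrans.ext (funext fun i => (h i).w)
  exact ⟨⟨w⟩, ⟨evaluationJointlyReflectsLimits _ fun i =>
    (isLimitMapConePullbackConeEquiv ((evaluation I C).obj i) w).symm (h i).isLimit⟩⟩

/-- Additive data on a bundle map, transported along an equality of bundle maps. -/
def AdditiveData.copy {A M : C} {p p' : A ⟶ M} (S : AdditiveData p) (_ : p = p') :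
    AdditiveData p' where
  A₂ := S.A₂
  fst := S.fst
  snd := S.snd
  add := S.add
  zero := S.zero

theorem AdditiveData.IsAdditive.copy {A M : C} {p p' : A ⟶ M} {S : AdditiveData p}
    (hS : S.IsAdditive) (h : p = p') : (S.copy h).IsAdditive := by
  subst h
  exact hS

theorem AdditiveData.IsHom.copy {A M B N : C} {p p' : A ⟶ M} {q q' : B ⟶ N} {S : AdditiveData p}
    {R : AdditiveData q} {f : A ⟶ B} {g : M ⟶ N} (h : S.IsHom R f g) (hp : p = p') (hq : q = q') :
    (S.copy hp).IsHom (R.copy hq) f g := by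
  subst hp
  subst hq
  exact h

namespace IndObj

variable {I : Type w} [SmallCategory I] [IsFiltered I]

/-- Finitely many generalized elements of `A` in the same fibre are represented by generalized
elements in the same fibre. -/
theorem exists_germ_eq_of_fibre {A M : I ⥤ C} (α : A ⟶ M) {Z : C}
    (x y z : Germ Z (IndObj.mk I A))
    (hxy : Germ.postcomp (ofNatTrans α) x = Germ.postcomp (ofNatTrans α) y)
    (hyz : Germ.postcomp (ofNatTrans α) y = Germ.postcomp (ofNatTrans α) z) :
    ∃ (i : I) (f g h : Z ⟶ A.obj i), f ≫ α.app i = g ≫ α.app i ∧ g ≫ α.app i = h ≫ α.app i ∧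
      x = germ (Y := IndObj.mk I A) i f ∧ y = germ (Y := IndObj.mk I A) i g ∧
      z = germ (Y := IndObj.mk I A) i h := by
  obtain ⟨i, f, hf⟩ := exists_germ_eq (fun _ : Fin 3 => A) ![x, y, z]
  obtain rfl : germ (Y := IndObj.mk I A) i (f 0) = x := hf 0
  obtain rfl : germ (Y := IndObj.mk I A) i (f 1) = y := hf 1
  obtain rfl : germ (Y := IndObj.mk I A) i (f 2) = z := hf 2
  obtain ⟨j, φ, e⟩ := exists_comp_map_eq_of_finite (fun _ : Bool => M)
    (fun t => cond t (f 0) (f 1) ≫ α.app i) (fun t => cond t (f 1) (f 2) ≫ α.app i)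
    (fun t => match t with | true => hxy | false => hyz)
  refine ⟨j, f 0 ≫ A.map φ, f 1 ≫ A.map φ, f 2 ≫ A.map φ, by simpa using e true,
    by simpa using e false, ?_, ?_, ?_⟩ <;>
  exact (germ_comp (Y := IndObj.mk I A) _ φ).symm

/-- The unit and commutativity laws are identities of natural transformations, so they are proved
for diagrams and transported by `ofDiagram`. Associativity ranges over generalized elements from an
arbitrary ind-object, possibly of another shape, and is therefore checked on germs. -/
theorem isAdditive_map_ofDiagram {A M : I ⥤ C} {α : A ⟶ M} (S : AdditiveData α)
    (h : ∀ i, (S.map ((evaluation I C).obj i)).IsAdditive) :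
    (S.map (ofDiagram I C)).IsAdditive := by
  have hp : ∀ i, IsPullback (S.fst.app i) (S.snd.app i) (α.app i) (α.app i) :=
    fun i => (h i).isPullback
  have hP : IsPullback S.fst S.snd α α := .of_forall_app hp
  have hL : IsPullback (ofNatTrans S.fst) (ofNatTrans S.snd) (ofNatTrans α) (ofNatTrans α) :=
    isPullback_ofNatTrans hp
  have hz : S.zero ≫ α = 𝟙 M := NatTrans.ext (funext fun i => (h i).zero_proj)
  have hadd : S.add ≫ α = S.fst ≫ α := NatTrans.ext (funext fun i => (h i).add_proj)
  exact
  { isPullback := hL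
    add_proj := congrArg ofNatTrans hadd
    zero_proj := congrArg ofNatTrans hz
    zero_add := by
      have e : hP.lift (α ≫ S.zero) (𝟙 A) (by simp [hz]) ≫ S.add = 𝟙 A := by
        refine NatTrans.ext (funext fun i => ?_)
        refine Eq.trans ?_ (h i).zero_add
        refine congrArg (· ≫ S.add.app i) ((hp i).hom_ext ?_ ?_)
        · refine Eq.trans ?_ ((h i).isPullback.lift_fst _ _ _).symm
          exact congrArg (fun t => NatTrans.app t i) (hP.lift_fst (α ≫ S.zero) (𝟙 A) _)
        · refine Eq.trans ?_ ((h i).isPullback.lift_snd _ _ _).symm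
          exact congrArg (fun t => NatTrans.app t i) (hP.lift_snd (α ≫ S.zero) (𝟙 A) _)
      refine Eq.trans ?_ ((ofNatTrans_comp _ _).symm.trans (congrArg ofNatTrans e))
      refine congrArg (· ≫ ofNatTrans S.add) (hL.hom_ext ?_ ?_)
      · exact (hL.lift_fst _ _ _).trans (congrArg ofNatTrans
          (hP.lift_fst (α ≫ S.zero) (𝟙 A) (by simp [hz])).symm)
      · exact (hL.lift_snd _ _ _).trans (congrArg ofNatTrans
          (hP.lift_snd (α ≫ S.zero) (𝟙 A) (by simp [hz])).symm)
    add_comm := by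
      have e : hP.lift S.snd S.fst hP.w.symm ≫ S.add = S.add := by
        refine NatTrans.ext (funext fun i => ?_)
        refine Eq.trans ?_ (h i).add_comm
        refine congrArg (· ≫ S.add.app i) ((hp i).hom_ext ?_ ?_)
        · refine Eq.trans ?_ ((h i).isPullback.lift_fst _ _ _).symm
          exact congrArg (fun t => NatTrans.app t i) (hP.lift_fst S.snd S.fst _)
        · refine Eq.trans ?_ ((h i).isPullback.lift_snd _ _ _).symm
          exact congrArg (fun t => NatTrans.app t i) (hP.lift_snd S.snd S.fst _)
      refine Eq.trans ?_ ((ofNatTrans_comp _ _).symm.trans (congrArg ofNatTrans e))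
      refine congrArg (· ≫ ofNatTrans S.add) (hL.hom_ext ?_ ?_)
      · exact (hL.lift_fst _ _ _).trans (congrArg ofNatTrans (hP.lift_fst _ _ _).symm)
      · exact (hL.lift_snd _ _ _).trans (congrArg ofNatTrans (hP.lift_snd _ _ _).symm)
    add_assoc := by
      intro W x y z hxy hyz
      refine hom_ext fun k => ?_
      -- All three elements are represented at one level and in one fibre there, so that
      -- associativity at level `i` applies.
      obtain ⟨i, f, g, l, hfg, hgl, hx, hy, hz⟩ := exists_germ_eq_of_fibre α
        (Hom.app x k) (Hom.app y k) (Hom.app z k) (congrArg (fun t => Hom.app t k) hxy)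
        (congrArg (fun t => Hom.app t k) hyz)
      have hS : S.add.app i ≫ α.app i = S.fst.app i ≫ α.app i := (h i).add_proj
      -- Sums of germs are computed on representatives.
      have key : ∀ (a b : W ⟶ IndObj.mk I A) (e : a ≫ ofNatTrans α = b ≫ ofNatTrans α)
          (a' b' : W.F.obj k ⟶ A.obj i) (e' : a' ≫ α.app i = b' ≫ α.app i),
          Hom.app a k = germ (Y := IndObj.mk I A) i a' →
          Hom.app b k = germ (Y := IndObj.mk I A) i b' →
          Hom.app (hL.lift a b e ≫ ofNatTrans S.add) k =
            germ (Y := IndObj.mk I A) i ((hp i).lift a' b' e' ≫ S.add.app i) := by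
        intro a b e a' b' e' ha hb
        have := app_lift_eq_germ hp hL a b e ((hp i).lift a' b' e') (by simpa using ha)
          (by simpa using hb)
        exact congrArg (Germ.postcomp (ofNatTrans S.add)) this
      have assoc := (h i).add_assoc f g l hfg hgl
      refine (key _ _ _ _ _ ?_ (key _ _ _ _ _ hfg hx hy) hz).trans
        (Eq.trans ?_ (key _ _ _ _ _ ?_ hx (key _ _ _ _ _ hgl hy hz)).symm)
      · simp [hS, hfg, hgl]
      · exact congrArg (germ (Y := IndObj.mk I A) i) assoc
      · simp [hS, hfg] }

/-- The levelwise maps of fibre squares are unique because the target squares are pullbacks, hence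
they are natural in `i`. -/
theorem isHom_map_ofDiagram {A M B N : I ⥤ C} {α : A ⟶ M} {β : B ⟶ N} (S : AdditiveData α)
    (R : AdditiveData β) (hR : ∀ i, IsPullback (R.fst.app i) (R.snd.app i) (β.app i) (β.app i))
    (f : A ⟶ B) (g : M ⟶ N)
    (h : ∀ i, (S.map ((evaluation I C).obj i)).IsHom (R.map ((evaluation I C).obj i)) (f.app i)
      (g.app i)) :
    (S.map (ofDiagram I C)).IsHom (R.map (ofDiagram I C)) (ofNatTrans f) (ofNatTrans g) := by
  have hk (i : I) : ∃ k : S.A₂.obj i ⟶ R.A₂.obj i, k ≫ R.fst.app i = S.fst.app i ≫ f.app i ∧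
      k ≫ R.snd.app i = S.snd.app i ≫ f.app i ∧ S.add.app i ≫ f.app i = k ≫ R.add.app i :=
    (h i).add
  choose k h₁ h₂ h₃ using hk
  let K : S.A₂ ⟶ R.A₂ :=
    { app := k
      naturality := fun i j φ => (hR j).hom_ext
        (by simp [h₁, reassoc_of% h₁]) (by simp [h₂, reassoc_of% h₂]) }
  exact
  { comm := ofNatTrans_congr (α := f ≫ β) (β := α ≫ g) fun i => (h i).comm
    add := ⟨ofNatTrans K, ofNatTrans_congr (α := K ≫ R.fst) (β := S.fst ≫ f) h₁,
      ofNatTrans_congr (α := K ≫ R.snd) (β := S.snd ≫ f) h₂,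
      ofNatTrans_congr (α := S.add ≫ f) (β := K ≫ R.add) h₃⟩
    zero := ofNatTrans_congr (α := S.zero ≫ f) (β := g ≫ R.zero) fun i => (h i).zero }

end IndObj

end LevelwiseAdditive

/-! ### The ind-tangent structure -/

namespace TangentData

variable {C : Type u} [Category.{v} C] (𝕋 : TangentData C)

section Diagrams

variable {I : Type w} [SmallCategory I] (F : I ⥤ C)

/-- The projections `p_{F i}`, as a natural transformation. -/
def projDiagram : F ⋙ 𝕋.T ⟶ F where
  app i := 𝕋.p.app (F.obj i)
  naturality _ _ φ := 𝕋.p.naturality (F.map φ)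

/-- The units `0_{F i}`, as a natural transformation. -/
def zeroDiagram : F ⟶ F ⋙ 𝕋.T where
  app i := 𝕋.zero.app (F.obj i)
  naturality _ _ φ := 𝕋.zero.naturality (F.map φ)

/-- The vertical lifts `ℓ_{F i}`, as a natural transformation. -/
def liftDiagram : F ⋙ 𝕋.T ⟶ (F ⋙ 𝕋.T) ⋙ 𝕋.T where
  app i := 𝕋.lift.app (F.obj i)
  naturality _ _ φ := 𝕋.lift.naturality (F.map φ)

/-- The canonical flips `c_{F i}`, as a natural transformation. -/
def flipDiagram : (F ⋙ 𝕋.T) ⋙ 𝕋.T ⟶ (F ⋙ 𝕋.T) ⋙ 𝕋.T where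
  app i := 𝕋.flip.app (F.obj i)
  naturality _ _ φ := 𝕋.flip.naturality (F.map φ)

/-- The additive data on the bundles `p_{F i}`. -/
def bundleDiagram : AdditiveData (𝕋.projDiagram F) where
  A₂ := F ⋙ 𝕋.T₂
  fst := Functor.whiskerLeft F 𝕋.fst
  snd := Functor.whiskerLeft F 𝕋.snd
  add := Functor.whiskerLeft F 𝕋.add
  zero := 𝕋.zeroDiagram F

end Diagrams

/-! ### Tangent axioms in the ind-category. -/

section Ind

variable {I : Type w} [SmallCategory I] [IsFiltered I] (F : I ⥤ C)

/-- The unitors and compositors in `TangentData.ind` leave identity factors; this lemma and the next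
three strip them, exposing images of natural transformations. -/
theorem ind_p_app : 𝕋.ind.p.app (IndObj.mk I F) = IndObj.ofNatTrans (𝕋.projDiagram F) :=
  Category.comp_id (IndObj.ofNatTrans (𝕋.projDiagram F))

theorem ind_zero_app : 𝕋.ind.zero.app (IndObj.mk I F) = IndObj.ofNatTrans (𝕋.zeroDiagram F) :=
  Category.id_comp (IndObj.ofNatTrans (𝕋.zeroDiagram F))

theorem ind_lift_app : 𝕋.ind.lift.app (IndObj.mk I F) = IndObj.ofNatTrans (𝕋.liftDiagram F) :=
  Category.comp_id (IndObj.ofNatTrans (𝕋.liftDiagram F))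

theorem ind_flip_app : 𝕋.ind.flip.app (IndObj.mk I F) = IndObj.ofNatTrans (𝕋.flipDiagram F) :=
  (Category.id_comp (IndObj.ofNatTrans (𝕋.flipDiagram F) ≫ 𝟙 _)).trans (Category.comp_id _)

theorem ind_bundle : 𝕋.ind.bundle (IndObj.mk I F) =
    ((𝕋.bundleDiagram F).map (IndObj.ofDiagram I C)).copy (𝕋.ind_p_app F).symm :=
  congrArg (AdditiveData.mk (p := 𝕋.ind.p.app (IndObj.mk I F)) _ _ _ _) (𝕋.ind_zero_app F)

variable {𝕋}

theorem IsTangent.isPullback (h : 𝕋.IsTangent) (X : C) :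
    IsPullback (𝕋.fst.app X) (𝕋.snd.app X) (𝕋.p.app X) (𝕋.p.app X) :=
  (h.additive X).isPullback

theorem IsTangent.isPullback_map (h : 𝕋.IsTangent) (X : C) :
    IsPullback (𝕋.T.map (𝕋.fst.app X)) (𝕋.T.map (𝕋.snd.app X)) (𝕋.T.map (𝕋.p.app X))
      (𝕋.T.map (𝕋.p.app X)) :=
  (h.powers X).isPullback_map (h.isPullback X)

/-- Universality of the vertical lift in the ind-category. -/
theorem IsTangent.ind_universal (h : 𝕋.IsTangent) :
    ∃ k : 𝕋.ind.T₂.obj (IndObj.mk I F) ⟶ 𝕋.ind.T.obj (𝕋.ind.T₂.obj (IndObj.mk I F)),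
    k ≫ 𝕋.ind.T.map (𝕋.ind.fst.app (IndObj.mk I F)) =
      𝕋.ind.fst.app (IndObj.mk I F) ≫ 𝕋.ind.lift.app (IndObj.mk I F) ∧
    k ≫ 𝕋.ind.T.map (𝕋.ind.snd.app (IndObj.mk I F)) =
      𝕋.ind.snd.app (IndObj.mk I F) ≫ 𝕋.ind.zero.app (𝕋.ind.T.obj (IndObj.mk I F)) ∧
    ∃ e : (k ≫ 𝕋.ind.T.map (𝕋.ind.add.app (IndObj.mk I F))) ≫
          𝕋.ind.T.map (𝕋.ind.p.app (IndObj.mk I F)) =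
        (k ≫ 𝕋.ind.T.map (𝕋.ind.add.app (IndObj.mk I F))) ≫
          𝕋.ind.p.app (𝕋.ind.T.obj (IndObj.mk I F)) ≫ 𝕋.ind.p.app (IndObj.mk I F) ≫
          𝕋.ind.zero.app (IndObj.mk I F),
      Nonempty (IsLimit (Fork.ofι (k ≫ 𝕋.ind.T.map (𝕋.ind.add.app (IndObj.mk I F))) e)) := by
  choose k h₁ h₂ h₃ h₄ using fun i => h.universal (F.obj i)
  -- The chosen `k i` are natural because `T` preserves the fibre square `T₂`, so they are
  -- determined by their two projections.
  let K : F ⋙ 𝕋.T₂ ⟶ (F ⋙ 𝕋.T₂) ⋙ 𝕋.T :=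
    { app := k
      naturality := fun i j φ => (h.isPullback_map (F.obj j)).hom_ext
        (by
          have e₁ := 𝕋.fst.naturality (F.map φ)
          have e₂ := 𝕋.lift.naturality (F.map φ)
          dsimp at e₁ e₂ ⊢
          rw [Category.assoc, h₁, reassoc_of% e₁, e₂, Category.assoc, ← 𝕋.T.map_comp, e₁,
            𝕋.T.map_comp, reassoc_of% h₁])
        (by
          have e₁ := 𝕋.snd.naturality (F.map φ)
          have e₂ := 𝕋.zero.naturality (𝕋.T.map (F.map φ))
          dsimp at e₁ e₂ ⊢
          rw [Category.assoc, h₂, reassoc_of% e₁, e₂, Category.assoc, ← 𝕋.T.map_comp, e₁,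
            𝕋.T.map_comp, reassoc_of% h₂]) }
  let μ : F ⋙ 𝕋.T₂ ⟶ (F ⋙ 𝕋.T) ⋙ 𝕋.T :=
    K ≫ Functor.whiskerRight (Functor.whiskerLeft F 𝕋.add) 𝕋.T
  let a : (F ⋙ 𝕋.T) ⋙ 𝕋.T ⟶ F ⋙ 𝕋.T := Functor.whiskerRight (𝕋.projDiagram F) 𝕋.T
  let b : (F ⋙ 𝕋.T) ⋙ 𝕋.T ⟶ F ⋙ 𝕋.T :=
    𝕋.projDiagram (F ⋙ 𝕋.T) ≫ 𝕋.projDiagram F ≫ 𝕋.zeroDiagram F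
  have e : μ ≫ a = μ ≫ b := NatTrans.ext (funext fun i => h₃ i)
  have hlim : IsLimit ((IndObj.ofDiagram I C).mapCone (Fork.ofι μ e)) :=
    IndObj.isLimitOfDiagramMapCone fun i =>
      (isLimitMapConeForkEquiv ((evaluation I C).obj i) e).symm (h₄ i).some
  have hlim' : IsLimit (Fork.ofι (IndObj.ofNatTrans μ) _) :=
    isLimitMapConeForkEquiv (IndObj.ofDiagram I C) e hlim
  refine ⟨IndObj.ofNatTrans K, ?_⟩
  rw [𝕋.ind_lift_app F, 𝕋.ind_p_app F, 𝕋.ind_zero_app F,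
    show 𝕋.ind.p.app (𝕋.ind.T.obj (IndObj.mk I F)) = _ from 𝕋.ind_p_app (F ⋙ 𝕋.T),
    show 𝕋.ind.zero.app (𝕋.ind.T.obj (IndObj.mk I F)) = _ from 𝕋.ind_zero_app (F ⋙ 𝕋.T)]
  exact ⟨IndObj.ofNatTrans_congr
      (α := K ≫ Functor.whiskerRight (Functor.whiskerLeft F 𝕋.fst) 𝕋.T)
      (β := Functor.whiskerLeft F 𝕋.fst ≫ 𝕋.liftDiagram F) h₁,
    IndObj.ofNatTrans_congr
      (α := K ≫ Functor.whiskerRight (Functor.whiskerLeft F 𝕋.snd) 𝕋.T)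
      (β := Functor.whiskerLeft F 𝕋.snd ≫ 𝕋.zeroDiagram (F ⋙ 𝕋.T)) h₂,
    congrArg IndObj.ofNatTrans e, ⟨hlim'⟩⟩

theorem IsTangent.ind (h : 𝕋.IsTangent) : (TangentData.ind.{w} 𝕋).IsTangent where
  powers := by
    rintro ⟨I, F⟩
    rw [ind_p_app]
    exact IndObj.hasPreservedPowers_ofNatTrans (𝕋.projDiagram F) fun i => h.powers (F.obj i)
  additive := by
    rintro ⟨I, F⟩
    rw [ind_bundle]
    exact (IndObj.isAdditive_map_ofDiagram (𝕋.bundleDiagram F)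
      fun i => h.additive (F.obj i)).copy _
  lift_hom := by
    rintro ⟨I, F⟩
    rw [ind_bundle, ind_lift_app, ind_zero_app]
    exact (IndObj.isHom_map_ofDiagram (𝕋.bundleDiagram F)
      ((𝕋.bundleDiagram F).map ((Functor.whiskeringRight I C C).obj 𝕋.T))
      (fun i => h.isPullback_map (F.obj i)) (𝕋.liftDiagram F) (𝕋.zeroDiagram F)
      fun i => h.lift_hom (F.obj i)).copy (𝕋.ind_p_app F).symm
        (congrArg 𝕋.ind.T.map (𝕋.ind_p_app F).symm)
  flip_hom := by
    rintro ⟨I, F⟩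
    have e := 𝕋.ind_bundle (F ⋙ 𝕋.T)
    change 𝕋.ind.bundle (𝕋.ind.T.obj (IndObj.mk I F)) = _ at e
    rw [e, ind_bundle, ind_flip_app]
    exact (IndObj.isHom_map_ofDiagram
      ((𝕋.bundleDiagram F).map ((Functor.whiskeringRight I C C).obj 𝕋.T))
      (𝕋.bundleDiagram (F ⋙ 𝕋.T))
      (fun i => h.isPullback (𝕋.T.obj (F.obj i))) (𝕋.flipDiagram F) (𝟙 (F ⋙ 𝕋.T))
      fun i => h.flip_hom (F.obj i)).copy (congrArg 𝕋.ind.T.map (𝕋.ind_p_app F).symm)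
        (𝕋.ind_p_app (F ⋙ 𝕋.T)).symm
  flip_flip := by
    rintro ⟨I, F⟩
    rw [ind_flip_app]
    exact IndObj.ofNatTrans_congr (α := 𝕋.flipDiagram F ≫ 𝕋.flipDiagram F) (β := 𝟙 _)
      fun i => h.flip_flip (F.obj i)
  lift_flip := by
    rintro ⟨I, F⟩
    rw [ind_flip_app, ind_lift_app]
    exact IndObj.ofNatTrans_congr (α := 𝕋.liftDiagram F ≫ 𝕋.flipDiagram F) (β := 𝕋.liftDiagram F)
      fun i => h.lift_flip (F.obj i)
  lift_lift := by
    rintro ⟨I, F⟩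
    rw [show 𝕋.ind.lift.app (𝕋.ind.T.obj (IndObj.mk I F)) = _ from 𝕋.ind_lift_app (F ⋙ 𝕋.T),
      ind_lift_app]
    exact IndObj.ofNatTrans_congr
      (α := 𝕋.liftDiagram F ≫ Functor.whiskerRight (𝕋.liftDiagram F) 𝕋.T)
      (β := 𝕋.liftDiagram F ≫ 𝕋.liftDiagram (F ⋙ 𝕋.T)) fun i => h.lift_lift (F.obj i)
  flip_braid := by
    rintro ⟨I, F⟩
    rw [show 𝕋.ind.flip.app (𝕋.ind.T.obj (IndObj.mk I F)) = _ from 𝕋.ind_flip_app (F ⋙ 𝕋.T),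
      ind_flip_app]
    exact IndObj.ofNatTrans_congr
      (α := Functor.whiskerRight (𝕋.flipDiagram F) 𝕋.T ≫ 𝕋.flipDiagram (F ⋙ 𝕋.T) ≫
        Functor.whiskerRight (𝕋.flipDiagram F) 𝕋.T)
      (β := 𝕋.flipDiagram (F ⋙ 𝕋.T) ≫ Functor.whiskerRight (𝕋.flipDiagram F) 𝕋.T ≫
        𝕋.flipDiagram (F ⋙ 𝕋.T)) fun i => h.flip_braid (F.obj i)
  lift_flip_flip := by
    rintro ⟨I, F⟩
    rw [show 𝕋.ind.flip.app (𝕋.ind.T.obj (IndObj.mk I F)) = _ from 𝕋.ind_flip_app (F ⋙ 𝕋.T),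
      show 𝕋.ind.lift.app (𝕋.ind.T.obj (IndObj.mk I F)) = _ from 𝕋.ind_lift_app (F ⋙ 𝕋.T),
      ind_flip_app, ind_lift_app]
    exact IndObj.ofNatTrans_congr
      (α := 𝕋.liftDiagram (F ⋙ 𝕋.T) ≫ Functor.whiskerRight (𝕋.flipDiagram F) 𝕋.T ≫
        𝕋.flipDiagram (F ⋙ 𝕋.T))
      (β := 𝕋.flipDiagram F ≫ Functor.whiskerRight (𝕋.liftDiagram F) 𝕋.T)
      fun i => h.lift_flip_flip (F.obj i)
  universal := by
    rintro ⟨I, F⟩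
    exact h.ind_universal F

end Ind

end TangentData

/-! ### Linear morphisms of differential bundles are additive -/

namespace DifferentialBundle

variable {C : Type u} [Category.{v} C] {𝕋 : TangentData C} {E M : C} {q : E ⟶ M}

theorem lift_comp_p (P : DifferentialBundle 𝕋 q) : P.lift ≫ 𝕋.p.app E = q ≫ P.str.zero :=
  P.lift_hom_tangent.comm

theorem lift_comp_map (P : DifferentialBundle 𝕋 q) :
    P.lift ≫ 𝕋.T.map q = q ≫ 𝕋.zero.app M :=
  P.lift_hom_map.comm

theorem isPullback_map (P : DifferentialBundle 𝕋 q) :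
    IsPullback (𝕋.T.map P.str.fst) (𝕋.T.map P.str.snd) (𝕋.T.map q) (𝕋.T.map q) :=
  P.powers.isPullback_map P.additive.isPullback

/-- The map `μ` is a pullback of the split monomorphism `0_M`, hence monic, and `λ = μ ∘ ⟨id, ζ q⟩`
with `⟨id, ζ q⟩` split by the first projection. -/
theorem mono_lift (h : 𝕋.IsTangent) (P : DifferentialBundle 𝕋 q) : Mono P.lift := by
  obtain ⟨k, h₁, h₂, h₃⟩ := P.universal
  have hμ : IsPullback (k ≫ 𝕋.T.map P.str.add) (P.str.snd ≫ q) (𝕋.T.map q) (𝕋.zero.app M) := h₃ 0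
  have hz : Mono (𝕋.zero.app M) := SplitMono.mono ⟨𝕋.p.app M, (h.additive M).zero_proj⟩
  have hm : Mono (k ≫ 𝕋.T.map P.str.add) :=
    ⟨fun x y e => hμ.hom_ext e ((cancel_mono (𝕋.zero.app M)).1 (by
      simpa only [Category.assoc, ← hμ.w] using congrArg (· ≫ 𝕋.T.map q) e))⟩
  let hA := P.additive.isPullback
  let s : E ⟶ P.str.A₂ := hA.lift (𝟙 E) (q ≫ P.str.zero) (by simp [P.additive.zero_proj])
  have hs₁ : s ≫ P.str.fst = 𝟙 E := hA.lift_fst _ _ _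
  have hs₂ : s ≫ P.str.snd = q ≫ P.str.zero := hA.lift_snd _ _ _
  -- The right unit law, deduced from the left one by commutativity.
  have hs : s ≫ P.str.add = 𝟙 E := by
    have e : s = hA.lift (q ≫ P.str.zero) (𝟙 E) (by simp [P.additive.zero_proj]) ≫
        hA.lift P.str.snd P.str.fst hA.w.symm := by
      apply hA.hom_ext <;> simp [hs₁, hs₂]
    rw [e, Category.assoc, P.additive.add_comm, P.additive.zero_add]
  have hz' : P.str.zero ≫ 𝕋.zero.app E = 𝕋.zero.app M ≫ 𝕋.T.map P.str.zero :=
    𝕋.zero.naturality P.str.zero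
  -- Second components agree since `0_E ζ q = T(ζ) 0_M q = T(ζ) T(q) λ`.
  have hk : s ≫ k = P.lift ≫ 𝕋.T.map s := by
    apply P.isPullback_map.hom_ext
    · simp only [Category.assoc, h₁, reassoc_of% hs₁, ← 𝕋.T.map_comp, hs₁, 𝕋.T.map_id,
        Category.comp_id]
    · rw [Category.assoc, h₂, reassoc_of% hs₂, hz', Category.assoc, ← 𝕋.T.map_comp, hs₂,
        𝕋.T.map_comp, reassoc_of% P.lift_comp_map]
  have hlift : s ≫ k ≫ 𝕋.T.map P.str.add = P.lift := by
    rw [reassoc_of% hk, ← 𝕋.T.map_comp, hs, 𝕋.T.map_id, Category.comp_id]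
  have : Mono s := mono_of_mono_fac hs₁
  rw [← hlift]
  exact mono_comp s _

/-- After composition with the monomorphism `Q.lift`, linearity and additivity of both lifts turn
the claim into naturality of the addition on tangent bundles. -/
theorem IsLinearHom.isHom (h : 𝕋.IsTangent) {F N : C} {r : F ⟶ N} {P : DifferentialBundle 𝕋 q}
    {Q : DifferentialBundle 𝕋 r} {f : E ⟶ F} {g : M ⟶ N} (hf : P.IsLinearHom Q f g) :
    P.str.IsHom Q.str f g where
  comm := hf.comm
  add := by
    let hQ := Q.additive.isPullback
    have w : (P.str.fst ≫ f) ≫ r = (P.str.snd ≫ f) ≫ r := by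
      simp only [Category.assoc, hf.comm, P.additive.isPullback.w_assoc]
    refine ⟨hQ.lift (P.str.fst ≫ f) (P.str.snd ≫ f) w, hQ.lift_fst _ _ _, hQ.lift_snd _ _ _, ?_⟩
    obtain ⟨k, h₁, h₂, h₃⟩ : ∃ k : P.str.A₂ ⟶ 𝕋.T₂.obj E,
        k ≫ 𝕋.fst.app E = P.str.fst ≫ P.lift ∧ k ≫ 𝕋.snd.app E = P.str.snd ≫ P.lift ∧
        P.str.add ≫ P.lift = k ≫ 𝕋.add.app E := P.lift_hom_tangent.add
    obtain ⟨l, l₁, l₂, l₃⟩ : ∃ l : Q.str.A₂ ⟶ 𝕋.T₂.obj F,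
        l ≫ 𝕋.fst.app F = Q.str.fst ≫ Q.lift ∧ l ≫ 𝕋.snd.app F = Q.str.snd ≫ Q.lift ∧
        Q.str.add ≫ Q.lift = l ≫ 𝕋.add.app F := Q.lift_hom_tangent.add
    have := Q.mono_lift h
    rw [← cancel_mono Q.lift, Category.assoc, Category.assoc, hf.lift, l₃, reassoc_of% h₃,
      ← 𝕋.add.naturality f, ← Category.assoc, ← Category.assoc]
    congr 1
    apply (h.isPullback F).hom_ext
    · have := 𝕋.fst.naturality f
      rw [Category.assoc, this, reassoc_of% h₁, Category.assoc, l₁, hQ.lift_fst_assoc,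
        Category.assoc, hf.lift]
    · have := 𝕋.snd.naturality f
      rw [Category.assoc, this, reassoc_of% h₂, Category.assoc, l₂, hQ.lift_snd_assoc,
        Category.assoc, hf.lift]
  zero := by
    have e : 𝕋.T.map f ≫ 𝕋.p.app F = 𝕋.p.app E ≫ f := 𝕋.p.naturality f
    -- From `ζ q = p λ` on both sides, with linearity and naturality of `p`; the section `ζ` then
    -- cancels `q`.
    have e' : q ≫ P.str.zero ≫ f = q ≫ g ≫ Q.str.zero := by
      rw [← reassoc_of% P.lift_comp_p, ← e, ← reassoc_of% hf.lift, Q.lift_comp_p,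
        reassoc_of% hf.comm]
    simpa [reassoc_of% P.additive.zero_proj] using congrArg (P.str.zero ≫ ·) e'

end DifferentialBundle

/-! ### Ind-objects of differential objects -/

namespace IndObj

variable {C : Type u} [Category.{v} C]

theorem germ_subsingleton {I : Type w} [SmallCategory I] [IsFiltered I] {X : C}
    (hX : IsTerminal X) {A : C} (x y : Germ A (IndObj.mk I ((Functor.const I).obj X))) : x = y := by
  induction x using Germ.ind with | h i f => ?_
  induction y using Germ.ind with | h j g => ?_
  exact (germ_eq_iff f g).2
    ⟨IsFiltered.max i j, IsFiltered.leftToMax i j, IsFiltered.rightToMax i j, hX.hom_ext _ _⟩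

/-- The constant ind-object on a terminal object is terminal. -/
noncomputable def isTerminalConst (I : Type w) [SmallCategory I] [IsFiltered I] {X : C}
    (hX : IsTerminal X) : IsTerminal (IndObj.mk I ((Functor.const I).obj X)) :=
  IsTerminal.ofUniqueHom
    (fun W => (⟨fun k => germ (Y := IndObj.mk I ((Functor.const I).obj X))
        -- Any index serves, since all germs into a constant terminal diagram coincide.
        (Classical.choice IsFiltered.nonempty) (hX.from (W.F.obj k)),
      fun _ => germ_subsingleton hX _ _⟩ : Hom W _))
    (fun _ _ => hom_ext fun _ => germ_subsingleton hX _ _)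

end IndObj

namespace AdditiveData.IsHom

variable {C : Type u} [Category.{v} C] {A M B N : C} {p : A ⟶ M} {q : B ⟶ N}
  {S : AdditiveData p} {R : AdditiveData q} {f : A ⟶ B} {g : M ⟶ N}

/-- The map between fibre squares induced by a morphism of additive bundles. -/
noncomputable def pairMap (h : S.IsHom R f g) : S.A₂ ⟶ R.A₂ :=
  h.add.choose

theorem pairMap_fst (h : S.IsHom R f g) : h.pairMap ≫ R.fst = S.fst ≫ f :=
  h.add.choose_spec.1

theorem pairMap_snd (h : S.IsHom R f g) : h.pairMap ≫ R.snd = S.snd ≫ f :=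
  h.add.choose_spec.2.1

theorem pairMap_add (h : S.IsHom R f g) : h.pairMap ≫ R.add = S.add ≫ f :=
  h.add.choose_spec.2.2.symm

end AdditiveData.IsHom

namespace DifferentialBundle

variable {C : Type u} [Category.{v} C] {𝕋 : TangentData C} {I : Type w} [SmallCategory I]
  {E M : I ⥤ C} {α : E ⟶ M} (P : ∀ i, DifferentialBundle 𝕋 (α.app i))
  (hP : ∀ {i j : I} (φ : i ⟶ j), (P i).str.IsHom (P j).str (E.map φ) (M.map φ))

/-- The additive data of a diagram of differential bundles and additive morphisms. -/
noncomputable def strDiagram : AdditiveData α where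
  A₂ :=
    { obj := fun i => (P i).str.A₂
      map := fun φ => (hP φ).pairMap
      map_id := fun i => (P i).additive.isPullback.hom_ext
        (by rw [(hP (𝟙 i)).pairMap_fst, E.map_id, Category.comp_id, Category.id_comp])
        (by rw [(hP (𝟙 i)).pairMap_snd, E.map_id, Category.comp_id, Category.id_comp])
      map_comp := fun φ ψ => (P _).additive.isPullback.hom_ext
        (by rw [(hP (φ ≫ ψ)).pairMap_fst, E.map_comp, Category.assoc, (hP ψ).pairMap_fst,
          reassoc_of% (hP φ).pairMap_fst])
        (by rw [(hP (φ ≫ ψ)).pairMap_snd, E.map_comp, Category.assoc, (hP ψ).pairMap_snd,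
          reassoc_of% (hP φ).pairMap_snd]) }
  fst :=
    { app := fun i => (P i).str.fst
      naturality := fun _ _ φ => (hP φ).pairMap_fst }
  snd :=
    { app := fun i => (P i).str.snd
      naturality := fun _ _ φ => (hP φ).pairMap_snd }
  add :=
    { app := fun i => (P i).str.add
      naturality := fun _ _ φ => (hP φ).pairMap_add }
  zero :=
    { app := fun i => (P i).str.zero
      naturality := fun _ _ φ => (hP φ).zero.symm }

/-- The maps `⟨λ π₀, 0 π₁⟩` are natural, being determined by projections that are; the universal
squares then transfer level by level, for every iterate of `T`. -/
theorem exists_ind_universal [IsFiltered I] (Λ : E ⟶ E ⋙ 𝕋.T)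
    (hΛ : ∀ i, Λ.app i = (P i).lift) :
    ∃ k : (IndObj.mk I (strDiagram P hP).A₂) ⟶ 𝕋.ind.T.obj (IndObj.mk I (strDiagram P hP).A₂),
      k ≫ 𝕋.ind.T.map (IndObj.ofNatTrans (strDiagram P hP).fst) =
        IndObj.ofNatTrans (strDiagram P hP).fst ≫ IndObj.ofNatTrans Λ ∧
      k ≫ 𝕋.ind.T.map (IndObj.ofNatTrans (strDiagram P hP).snd) =
        IndObj.ofNatTrans (strDiagram P hP).snd ≫ 𝕋.ind.zero.app (IndObj.mk I E) ∧
      ∀ n : ℕ, IsPullback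
        ((𝕋.ind.T.power n).map (k ≫ 𝕋.ind.T.map (IndObj.ofNatTrans (strDiagram P hP).add)))
        ((𝕋.ind.T.power n).map
          (IndObj.ofNatTrans (strDiagram P hP).snd ≫ IndObj.ofNatTrans α))
        ((𝕋.ind.T.power n).map (𝕋.ind.T.map (IndObj.ofNatTrans α)))
        ((𝕋.ind.T.power n).map (𝕋.ind.zero.app (IndObj.mk I M))) := by
  choose k h₁ h₂ h₃ using fun i => (P i).universal
  have hk {i j : I} (φ : i ⟶ j) : (hP φ).pairMap ≫ k j = k i ≫ 𝕋.T.map (hP φ).pairMap := by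
    have e₁ := (hP φ).pairMap_fst
    have e₂ := (hP φ).pairMap_snd
    have e₃ : E.map φ ≫ (P j).lift = (P i).lift ≫ 𝕋.T.map (E.map φ) := by
      rw [← hΛ, ← hΛ]
      exact Λ.naturality φ
    have e₄ : E.map φ ≫ 𝕋.zero.app (E.obj j) = 𝕋.zero.app (E.obj i) ≫ 𝕋.T.map (E.map φ) :=
      𝕋.zero.naturality (E.map φ)
    apply (P j).isPullback_map.hom_ext
    · rw [Category.assoc, h₁, reassoc_of% e₁, e₃, Category.assoc, ← 𝕋.T.map_comp, e₁,
        𝕋.T.map_comp, reassoc_of% h₁]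
    · rw [Category.assoc, h₂, reassoc_of% e₂, e₄, Category.assoc, ← 𝕋.T.map_comp, e₂,
        𝕋.T.map_comp, reassoc_of% h₂]
  let K : (strDiagram P hP).A₂ ⟶ (strDiagram P hP).A₂ ⋙ 𝕋.T :=
    { app := k
      naturality := fun _ _ φ => hk φ }
  refine ⟨IndObj.ofNatTrans K, ?_, ?_, fun n => ?_⟩
  · exact IndObj.ofNatTrans_congr (α := K ≫ Functor.whiskerRight (strDiagram P hP).fst 𝕋.T)
      (β := (strDiagram P hP).fst ≫ Λ)
      fun i => (h₁ i).trans (congrArg ((P i).str.fst ≫ ·) (hΛ i).symm)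
  · rw [𝕋.ind_zero_app]
    exact IndObj.ofNatTrans_congr (α := K ≫ Functor.whiskerRight (strDiagram P hP).snd 𝕋.T)
      (β := (strDiagram P hP).snd ≫ 𝕋.zeroDiagram E) h₂
  · rw [𝕋.ind_zero_app]
    exact IndObj.isPullback_map_of_levelwise (IndObj.ofDiagramCompPower I 𝕋.T n)
      (a := K ≫ Functor.whiskerRight (strDiagram P hP).add 𝕋.T) (b := (strDiagram P hP).snd ≫ α)
      (f := Functor.whiskerRight α 𝕋.T) (g := 𝕋.zeroDiagram M) fun i => h₃ i n

/-- A filtered diagram of differential bundles, with additive transition morphisms that preserve the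
lifts, is a differential bundle in the ind-category. -/
noncomputable def ind [IsFiltered I] (h : 𝕋.IsTangent) (Λ : E ⟶ E ⋙ 𝕋.T)
    (hΛ : ∀ i, Λ.app i = (P i).lift) :
    DifferentialBundle (TangentData.ind.{w} 𝕋) (IndObj.ofNatTrans α) where
  str := (strDiagram P hP).map (IndObj.ofDiagram I C)
  lift := IndObj.ofNatTrans Λ
  additive := IndObj.isAdditive_map_ofDiagram _ fun i => (P i).additive
  powers := IndObj.hasPreservedPowers_ofNatTrans α fun i => (P i).powers
  lift_hom_map := by
    rw [𝕋.ind_zero_app]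
    refine IndObj.isHom_map_ofDiagram (strDiagram P hP)
      ((strDiagram P hP).map ((Functor.whiskeringRight I C C).obj 𝕋.T))
      (fun i => (P i).isPullback_map) Λ (𝕋.zeroDiagram M) fun i => ?_
    rw [hΛ]
    exact (P i).lift_hom_map
  lift_hom_tangent := by
    rw [𝕋.ind_bundle]
    refine (IndObj.isHom_map_ofDiagram (strDiagram P hP) (𝕋.bundleDiagram E)
      (fun i => h.isPullback (E.obj i)) Λ (strDiagram P hP).zero fun i => ?_).copy rfl
      (𝕋.ind_p_app E).symm
    rw [hΛ]
    exact (P i).lift_hom_tangent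
  universal := exists_ind_universal P hP Λ hΛ
  lift_lift := by
    rw [𝕋.ind_lift_app]
    refine IndObj.ofNatTrans_congr (α := Λ ≫ 𝕋.liftDiagram E) (β := Λ ≫ Functor.whiskerRight Λ 𝕋.T)
      fun i => ?_
    have := (P i).lift_lift
    rw [← hΛ] at this
    exact this

end DifferentialBundle

theorem mainTheorem8 {C : Type u} [Category.{v} C] [HasFiniteProducts C]
    (𝕋 : TangentData C) (h𝕋 : 𝕋.IsTangent)
    {I : Type w} [SmallCategory I] [IsFiltered I] (E : I ⥤ C)
    (P : ∀ i : I, DifferentialBundle 𝕋 (terminal.from (E.obj i)))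
    (hP : ∀ {i i' : I} (φ : i ⟶ i'),
      ∃ g : ⊤_ C ⟶ ⊤_ C, (P i).IsLinearHom (P i') (E.map φ) g) :
    (TangentData.ind.{w} 𝕋).IsTangent ∧
      IsDifferentialObject (TangentData.ind.{w} 𝕋) (IndObj.mk I E) := by
  refine ⟨h𝕋.ind, _, IndObj.isTerminalConst I (terminalIsTerminal (C := C)), ?_⟩
  let α : E ⟶ (Functor.const I).obj (⊤_ C) := { app := fun i => terminal.from (E.obj i) }
  let Λ : E ⟶ E ⋙ 𝕋.T :=
    { app := fun i => (P i).lift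
      naturality := fun i j φ => (hP φ).choose_spec.lift }
  -- The bundle map demanded by `IsDifferentialObject` is the abstract map to the terminal object;
  -- uniqueness identifies it with the levelwise one.
  have hα : (IndObj.isTerminalConst I (terminalIsTerminal (C := C))).from (IndObj.mk I E) =
      IndObj.ofNatTrans α := IsTerminal.hom_ext (IndObj.isTerminalConst I terminalIsTerminal) _ _
  rw [hα]
  refine ⟨DifferentialBundle.ind (α := α) P (fun {i j} φ => ?_) h𝕋 Λ fun _ => rfl⟩
  obtain ⟨g, hg⟩ := hP φ
  -- The base component is forced to be the identity, the transition map of the constant diagram.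
  obtain rfl : g = 𝟙 _ := terminal.hom_ext _ _
  exact hg.isHom h𝕋
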